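/- Let $N\ge 3$, $d\in\{2,3\}$, $\bar\rho>0$, and let $R(\alpha)$ be the rotation of $\mathbb R^2$ by $\alpha$ (if $d=2$), resp. the rotation of $\mathbb R^3$ by $\alpha$ about the axis $(0,0,1)^\top$ (if $d=3$). Agents $x_1,\dots,x_N\in\mathbb R^d$ (indices modulo $N$) obey $\dot x_i=u_i$ with $$u_i=R(\pi/N)(x_{i+1}-x_i)+R(\pi/N)^\top(x_{i-1}-x_i)\quad(i=2,\dots,N),$$ $$u_1=R(\pi/N)(x_2-x_1)+R(\pi/N)^\top(x_N-x_1)+f_r(\|x_2-x_1\|^2-\bar\rho)\,(x_2-x_1),$$ where $f_r:\mathbb R\to\mathbb R$ is $C^1$, $f_r(0)=0$ and $f_r'(p)>0$ for all $p\ge-\bar\rho$. Let $$\mathcal M_n=\{x: x_{i+1}-x_i=R(2\pi/N)(x_{i+2}-x_{i+1})\ \forall i\},\qquad \mathcal M_{n\bar\rho}=\{x\in\mathcal M_n:\ \|x_{i+1}-x_i\|^2=\bar\rho\ \forall i\}$$ (regular formations, and regular formations with squared neighbour separation $\bar\rho$). Notation. $L_1$ is the $N\times N$ matrix with $(L_1x)_i=x_i-x_{i+1}$,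 and $\mathcal L_s=L_1\otimes R(\pi/N)+L_1^\top\otimes R(\pi/N)^\top$. $V_{rn}$ is the matrix of full row rank with null space $\mathcal M_n$ whose rows are the first $N-2$ block rows of $x\mapsto(-x_i+(I+R(2\pi/N))x_{i+1}-R(2\pi/N)x_{i+2})_i$ and, if $d=3$, also the third row of block row $N-1$. $D_1$ is the first block column of $V_{rn}$, $D_2=[-I\ I\ 0\cdots0]$, $D=D_2\mathcal L_sV_{rn}^\top$, and $A_1$ is the matrix with $(A_1x)_1=x_2-x_1$ and $(A_1x)_i=0$ for $i\ne1$; $\nabla_xf_r=2f_r'(\|x_2-x_1\|^2-\bar\rho)(x_2-x_1)^\top D_2$ is the gradient (row vector) of $x\mapsto f_r(\|x_2-x_1\|^2-\bar\rho)$. For the scaling $\Theta=\mathrm{diag}(I,\theta)$, with a constant $\theta>0$, the scaled Jacobian of the auxiliary system with state $(Vx,f_r)$ is $$J_y(x)=\begin{pmatrix}-V_{rn}\mathcal L_sV_{rn}^\top&\theta^{-1}V_{rn}A_1x\\-\theta(\nabla_xf_r)\mathcal L_sV_{rn}^\top&(\nabla_xf_r)A_1x\end{pmatrix}.$$ A solution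 $x:[0,\infty)\to(\mathbb R^d)^N$ is said to converge exponentially with rate $r$ to a regular formation of the desired size if there are $\bar x\in\mathcal M_{n\bar\rho}$ and $C$ with $\|x_i(t)-\bar x_i\|\le Ce^{-rt}$ for all $t\ge0$ and all $i$. Claim. (a) Suppose that for every slope $s=f_r'(p)$, $p\ge-\bar\rho$, the Schur-complement condition $$\tfrac14\,(D_1^\top-2\theta^2sD)\,(V_{rn}\mathcal L_sV_{rn}^\top)^{-1}(D_1^\top-2\theta^2sD)^\top<2\theta^2s\,I$$ holds. Then every initial state is the initial value of a solution on $[0,\infty)$, and there is $r>0$ such that every solution on $[0,\infty)$ converges exponentially with rate $r$ to a regular formation of the desired size, except for the solutions that collapse, i.e. for which $\|x_i(t)-x_j(t)\|\to0$ as $t\to\infty$ for all $i,j$. (b) For every $c>0$ there is $r>0$ such that every solution on $[0,\infty)$ along which $J_y$ is uniformly negative definite, $v^\top J_y(x(t))v\le-c\|v\|^2$ for all $t\ge0$ and all $v$, converges exponentially with rate $r$ to a regular formation of the desired size. -/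

import Mathlib

open scoped Kronecker Topology
open Filter Matrix

noncomputable section

/-- Positions of `N` agents in `ℝ^d`. The agents are indexed cyclically by `ZMod N`;
agent `0` is the leader and agent `1` is its successor
(agents `1` and `2` when counted from one). -/
abbrev Config (N d : ℕ) : Type := ZMod N → EuclideanSpace ℝ (Fin d)

/-- The overall state vector, obtained by stacking the agents' coordinates. -/
def stack {N d : ℕ} (x : Config N d) : ZMod N × Fin d → ℝ := fun q => x q.1 q.2

/-- The rotation of angle `α` of the plane of the first two coordinates. For `d = 2` it is the usual
rotation matrix, for `d = 3` the rotation about the axis `(0, 0, 1)`. -/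
def rot (d : ℕ) (α : ℝ) : Matrix (Fin d) (Fin d) ℝ :=
  Matrix.of fun k l =>
    if (k : ℕ) < 2 ∧ (l : ℕ) < 2 then
      (if k = l then Real.cos α else if k < l then -Real.sin α else Real.sin α)
    else if k = l then 1 else 0

/-- A matrix acting on one agent's position. -/
def act {d : ℕ} (A : Matrix (Fin d) (Fin d) ℝ) (v : EuclideanSpace ℝ (Fin d)) :
    EuclideanSpace ℝ (Fin d) :=
  WithLp.toLp 2 (A *ᵥ v.ofLp)

/-- The argument `‖x₂ - x₁‖² - ρ` of the leader's gain. -/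
def sizeError {N d : ℕ} (ρ : ℝ) (x : Config N d) : ℝ := ‖x 1 - x 0‖ ^ 2 - ρ

/-- The control law: every agent uses the symmetric cyclic law with rotation `R(π/N)`, and the
leader adds the term `f (‖x₂ - x₁‖² - ρ) (x₂ - x₁)`. -/
def controlLaw (N d : ℕ) (f : ℝ → ℝ) (ρ : ℝ) (x : Config N d) : Config N d := fun i =>
  act (rot d (Real.pi / N)) (x (i + 1) - x i)
    + act (rot d (Real.pi / N))ᵀ (x (i - 1) - x i)
    + if i = 0 then f (sizeError ρ x) • (x 1 - x 0) else 0

/-- `x` is a solution on `[0, ∞)` of the closed loop of single integrators `ẋᵢ = uᵢ(x)`. -/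
def IsSolution (N d : ℕ) [NeZero N] (f : ℝ → ℝ) (ρ : ℝ) (x : ℝ → Config N d) : Prop :=
  ∀ t : ℝ, 0 ≤ t → HasDerivWithinAt x (controlLaw N d f ρ (x t)) (Set.Ici 0) t

/-- The manifold of regular formations: each side is the rotation by `2π/N` of the next one. -/
def regularFormations (N d : ℕ) : Set (Config N d) :=
  {x | ∀ i, x (i + 1) - x i = act (rot d (2 * Real.pi / N)) (x (i + 2) - x (i + 1))}

/-- The regular formations in which the squared distance of neighbouring agents is `ρ`. -/
def sizedFormations (N d : ℕ) (ρ : ℝ) : Set (Config N d) :=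
  {x | x ∈ regularFormations N d ∧ ∀ i, ‖x (i + 1) - x i‖ ^ 2 = ρ}

/-- `x(t)` converges, exponentially with rate `r`, to a regular formation of squared side `ρ`. -/
def ConvergesExp (N d : ℕ) (ρ r : ℝ) (x : ℝ → Config N d) : Prop :=
  ∃ z ∈ sizedFormations N d ρ, ∃ C : ℝ, ∀ t : ℝ, 0 ≤ t → ∀ i,
    ‖x t i - z i‖ ≤ C * Real.exp (-(r * t))

/-- The cyclic Laplacian `L₁`. -/
def cyclicLaplacian (N : ℕ) : Matrix (ZMod N) (ZMod N) ℝ :=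
  Matrix.of fun i j => (if j = i then 1 else 0) - (if j = i + 1 then 1 else 0)

/-- `𝓛ₛ = L₁ ⊗ R(π/N) + L₁ᵀ ⊗ R(π/N)ᵀ`. -/
def symLaplacian (N d : ℕ) : Matrix (ZMod N × Fin d) (ZMod N × Fin d) ℝ :=
  cyclicLaplacian N ⊗ₖ rot d (Real.pi / N) + (cyclicLaplacian N)ᵀ ⊗ₖ (rot d (Real.pi / N))ᵀ

/-- Row labels of `Vrn`: the first `N - 2` block rows and, for `d = 3`, also the axial row of the
block row after them (without it the null space would contain helices, which do not close up). -/
abbrev VRow (N d : ℕ) : Type :=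
  {q : ZMod N × Fin d // q.1.val + 2 < N ∨ (q.1.val + 2 = N ∧ 2 ≤ (q.2 : ℕ))}

/-- The matrix with block rows `(… 0, -I, I + R(2π/N), -R(2π/N), 0 …)`, of full row rank and
with null space `regularFormations N d`. -/
def Vrn (N d : ℕ) : Matrix (VRow N d) (ZMod N × Fin d) ℝ :=
  Matrix.of fun p q =>
    -(if q.1 = p.1.1 then (1 : Matrix (Fin d) (Fin d) ℝ) p.1.2 q.2 else 0)
      + (if q.1 = p.1.1 + 1 then (1 + rot d (2 * Real.pi / N)) p.1.2 q.2 else 0)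
      - (if q.1 = p.1.1 + 2 then rot d (2 * Real.pi / N) p.1.2 q.2 else 0)

/-- `D₂ = [-I, I, 0, …, 0]`, so that `D₂ x = x₂ - x₁`. -/
def D₂ (N d : ℕ) : Matrix (Fin d) (ZMod N × Fin d) ℝ :=
  Matrix.of fun k q =>
    if q.2 = k then (if q.1 = 1 then 1 else 0) - (if q.1 = 0 then 1 else 0) else 0

/-- `A₁`: first block row `(-I, I, 0, …, 0)`, all other block rows zero. -/
def A₁ (N d : ℕ) : Matrix (ZMod N × Fin d) (ZMod N × Fin d) ℝ :=
  Matrix.of fun p q => if p.1 = 0 then D₂ N d p.2 q else 0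

/-- `D₁`, the first block column of `Vrn` (for `d = 2` this is `(-I, 0, …, 0)ᵀ`), so that
`Vrn A₁ x = D₁ (x₂ - x₁)`. -/
def D₁ (N d : ℕ) : Matrix (VRow N d) (Fin d) ℝ :=
  (Vrn N d).submatrix id fun k => (0, k)

/-- `Vrn 𝓛ₛ Vrnᵀ`. -/
def projLaplacian (N d : ℕ) [NeZero N] : Matrix (VRow N d) (VRow N d) ℝ :=
  Vrn N d * symLaplacian N d * (Vrn N d)ᵀ

/-- `D = D₂ 𝓛ₛ Vrnᵀ`. -/
def D (N d : ℕ) [NeZero N] : Matrix (Fin d) (VRow N d) ℝ :=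
  D₂ N d * symLaplacian N d * (Vrn N d)ᵀ

/-- The Schur-complement condition at slope `s` with scaling `Θ = diag(I, θ)`:
`¼ (D₁ᵀ - 2θ²s D) (Vrn 𝓛ₛ Vrnᵀ)⁻¹ (D₁ᵀ - 2θ²s D)ᵀ < 2θ²s I`. -/
def SchurCondition (N d : ℕ) [NeZero N] (θ s : ℝ) : Prop :=
  ((2 * θ ^ 2 * s) • (1 : Matrix (Fin d) (Fin d) ℝ)
    - (1 / 4 : ℝ) • (((D₁ N d)ᵀ - (2 * θ ^ 2 * s) • D N d) * (projLaplacian N d)⁻¹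
        * ((D₁ N d)ᵀ - (2 * θ ^ 2 * s) • D N d)ᵀ)).PosDef

/-- The gradient of `x ↦ f (‖x₂ - x₁‖² - ρ)`, i.e. `2 f' (x₂ - x₁)ᵀ D₂`. -/
def gradGain {N d : ℕ} (f : ℝ → ℝ) (ρ : ℝ) (x : Config N d) : ZMod N × Fin d → ℝ :=
  (2 * deriv f (sizeError ρ x)) • ((x 1 - x 0).ofLp ᵥ* D₂ N d)

/-- The scaled Jacobian `J_y` of the auxiliary system with state `(V x, f (‖x₂ - x₁‖² - ρ))`. -/
def auxJacobian (N d : ℕ) [NeZero N] (f : ℝ → ℝ) (ρ θ : ℝ) (x : Config N d) :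
    Matrix (VRow N d ⊕ Unit) (VRow N d ⊕ Unit) ℝ :=
  Matrix.fromBlocks
    (-projLaplacian N d)
    (Matrix.replicateCol Unit (θ⁻¹ • (Vrn N d *ᵥ (A₁ N d *ᵥ stack x))))
    (Matrix.replicateRow Unit (-(θ • (gradGain f ρ x ᵥ* (symLaplacian N d * (Vrn N d)ᵀ)))))
    (Matrix.of fun _ _ => gradGain f ρ x ⬝ᵥ (A₁ N d *ᵥ stack x))

end

/-! Stacking the agents gives `ẋ = -L x + φ B u`, with `u = G x` the leading side and `φ = f (|u|² -
ρ)`. For `z = (V Vᵀ)⁻¹ V x`, the vector `Vᵀ z` is the projection of `x` off the null space of `V`,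
which is also that of `L`. The Lyapunov function is `E = |Vᵀ z|² + θ² φ²`. Its derivative is twice a
quadratic form in `(z, φ u)` that depends on the state only through the slope of `f`
(`energy_deriv_field`). The form of `J_y` at `(z, θ φ)` has the same value (`auxJacobian_form`).

Completing the square in `z` turns the Schur condition into negative definiteness of this form
(`dissip_neg_of_schur`). Definiteness keeps the slopes away from zero, so `f` grows at least
linearly and sublevel sets of `E` bound `z` and `u`. Forward solutions are therefore global.

A collapsed state has `E = θ² f(-ρ)²`. Strictly below that level `u` stays away from zero and `E`
decays exponentially. If `E` never falls below it, then `E' ≤ -c (|z|² + |u|²)`, and a Barbalat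
argument gives `z, u → 0`, which is collapse. Under the Jacobian hypothesis `E` decays exponentially
at once. In every decaying case the speed is `O(√E)`, so the solution has a limit, and there `E = 0`
(`IsForwardSolution.convergesToSized`).

For the formation matrices three facts remain: `symLaplacian` is positive semidefinite, its null
space is that of `Vrn`, and `Vrn` has full row rank. The first follows by untwisting the rotations
into antiperiodic sequences, the others from identities for sums around the cycle. -/

/-! ### Homogeneous forms and derivatives of products -/

/-- A uniformly negative comparison of two continuous functions that are homogeneous of degree two
in the second variable. -/
theorem exists_pos_forall_le_neg_mul_of_homogeneous {E : Type*} [NormedAddCommGroup E]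
    [NormedSpace ℝ E] [FiniteDimensional ℝ E] {K : Set ℝ} (hK : IsCompact K)
    {w : ℝ → E → ℝ} (hw : Continuous fun q : ℝ × E => w q.1 q.2)
    (hw2 : ∀ s r e, w s (r • e) = r ^ 2 * w s e)
    {g : E → ℝ} (hg : Continuous g) (hg2 : ∀ (r : ℝ) e, g (r • e) = r ^ 2 * g e)
    (hneg : ∀ s ∈ K, ∀ e, e ≠ 0 → w s e < 0) :
    ∃ c : ℝ, 0 < c ∧ ∀ s ∈ K, ∀ e, w s e ≤ -c * g e := by
  have hS : IsCompact (K ×ˢ Metric.sphere (0 : E) 1) := hK.prod (isCompact_sphere 0 1)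
  rcases (K ×ˢ Metric.sphere (0 : E) 1).eq_empty_or_nonempty with hemp | hne
  · refine ⟨1, one_pos, fun s hs e => ?_⟩
    have h0 : e = 0 := by
      by_contra he
      have : (s, (‖e‖⁻¹ : ℝ) • e) ∈ K ×ˢ Metric.sphere (0 : E) 1 := by
        refine ⟨hs, ?_⟩
        simp [norm_smul, he]
      rw [hemp] at this
      exact this
    have h1 := hw2 s 0 e
    have h2 := hg2 0 e
    simp only [h0, smul_zero] at h1 h2
    subst h0
    nlinarith
  -- By homogeneity it suffices to compare on `K ×ˢ sphere`, where `w` has a negative maximum and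
  -- `|g| ≤ M`; the quotient uses `M + 1` because `M` may vanish.
  · obtain ⟨a, ha, hamax⟩ := hS.exists_isMaxOn hne hw.continuousOn
    obtain ⟨b, hb, hbmax⟩ := hS.exists_isMaxOn hne
      (f := fun q : ℝ × E => |g q.2|) (by fun_prop)
    have hane : a.2 ≠ 0 := by
      intro h
      have := ha.2
      simp [h] at this
    have hwa : w a.1 a.2 < 0 := hneg _ ha.1 _ hane
    set M := |g b.2|
    have hM : 0 ≤ M := abs_nonneg _
    refine ⟨-(w a.1 a.2) / (M + 1), by apply div_pos <;> linarith, fun s hs e => ?_⟩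
    by_cases he : e = 0
    · subst he
      have h1 := hw2 s 0 0
      have h2 := hg2 0 0
      simp only [smul_zero] at h1 h2
      have h1' : w s 0 = 0 := by linarith
      have h2' : g 0 = 0 := by linarith
      simp [h1', h2']
    · have hn : 0 < ‖e‖ := norm_pos_iff.mpr he
      set e' := (‖e‖⁻¹ : ℝ) • e
      have hmem : (s, e') ∈ K ×ˢ Metric.sphere (0 : E) 1 := ⟨hs, by simp [e', norm_smul, he]⟩
      have hee : e = ‖e‖ • e' := by simp [e', smul_smul, hn.ne']
      have h1 : w s e' ≤ w a.1 a.2 := hamax hmem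
      have h2 : |g e'| ≤ M := hbmax hmem
      rw [hee, hw2, hg2]
      have h3 : w s e' ≤ -(-(w a.1 a.2) / (M + 1)) * g e' := by
        have h4 : g e' ≤ M + 1 := by linarith [le_abs_self (g e')]
        have h5 : -(-(w a.1 a.2) / (M + 1)) * g e' = w a.1 a.2 * (g e' / (M + 1)) := by
          field_simp
        rw [h5]
        have h6 : g e' / (M + 1) ≤ 1 := by rw [div_le_one (by linarith)]; exact h4
        nlinarith
      nlinarith [sq_nonneg ‖e‖]

theorem HasDerivWithinAt.mulVec_const {ι κ : Type*} [Fintype ι] [Fintype κ] (M : Matrix κ ι ℝ)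
    {x : ℝ → ι → ℝ} {x' : ι → ℝ} {s : Set ℝ} {t : ℝ} (h : HasDerivWithinAt x x' s t) :
    HasDerivWithinAt (fun τ => M *ᵥ x τ) (M *ᵥ x') s t :=
  (LinearMap.toContinuousLinearMap M.mulVecLin).hasFDerivAt.comp_hasDerivWithinAt t h

theorem HasDerivWithinAt.dotProduct {ι : Type*} [Fintype ι] {x y : ℝ → ι → ℝ} {x' y' : ι → ℝ}
    {s : Set ℝ} {t : ℝ} (hx : HasDerivWithinAt x x' s t) (hy : HasDerivWithinAt y y' s t) :
    HasDerivWithinAt (fun τ => x τ ⬝ᵥ y τ) (x' ⬝ᵥ y t + x t ⬝ᵥ y') s t := by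
  have := HasDerivWithinAt.fun_sum (u := Finset.univ) fun i _ =>
    ((hasDerivWithinAt_pi.1 hx i).mul (hasDerivWithinAt_pi.1 hy i))
  refine HasDerivWithinAt.congr_deriv (f := fun τ => x τ ⬝ᵥ y τ) this ?_
  simp [_root_.dotProduct, Finset.sum_add_distrib]

theorem dotProduct_self_nonneg' {ι : Type*} [Fintype ι] (v : ι → ℝ) : 0 ≤ v ⬝ᵥ v :=
  Finset.sum_nonneg fun i _ => mul_self_nonneg (v i)

/-! ### Abstract shape systems and the Lyapunov identity -/

/-- The data of the closed loop: a Laplacian `L`, the matrix `V` of shape errors, the input matrix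
`B` of the leader and the matrix `G` that measures the leading side. -/
structure ShapeSystem (n m k : Type*) [Fintype n] [Fintype m] [Fintype k] [DecidableEq k] where
  L : Matrix n n ℝ
  V : Matrix m n ℝ
  B : Matrix n k ℝ
  G : Matrix k n ℝ
  posSemidef : L.PosSemidef
  mulVec_eq_zero_iff : ∀ x, V *ᵥ x = 0 ↔ L *ᵥ x = 0
  eq_zero_of_transpose : ∀ z, Vᵀ *ᵥ z = 0 → z = 0
  G_mul_B : G * B = -1
  V_mul_B_ne_zero : V * B ≠ 0

namespace ShapeSystem

variable {n m k : Type*} [Fintype n] [Fintype m] [Fintype k] [DecidableEq k] [DecidableEq m]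
  (S : ShapeSystem n m k)

/-- The Gram matrix of the shape errors. -/
def gram : Matrix m m ℝ := S.V * S.Vᵀ

/-- The matrix of the shape coordinates `z`, for which `Vᵀ z` is the part of the state orthogonal
to the null space of `V`. -/
noncomputable def coord : Matrix m n ℝ := S.gram⁻¹ * S.V

/-- The Laplacian in shape coordinates. -/
def proj : Matrix m m ℝ := S.V * S.L * S.Vᵀ

/-- The squared length of the leading side. -/
def sqSide (x : n → ℝ) : ℝ := (S.G *ᵥ x) ⬝ᵥ (S.G *ᵥ x)

/-- The value of the gain. -/
def gain (f : ℝ → ℝ) (ρ : ℝ) (x : n → ℝ) : ℝ := f (S.sqSide x - ρ)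

/-- The closed-loop vector field. -/
def field (f : ℝ → ℝ) (ρ : ℝ) (x : n → ℝ) : n → ℝ :=
  -(S.L *ᵥ x) + S.gain f ρ x • (S.B *ᵥ (S.G *ᵥ x))

/-- The Lyapunov function. -/
noncomputable def energy (f : ℝ → ℝ) (ρ θ : ℝ) (x : n → ℝ) : ℝ :=
  (S.coord *ᵥ x) ⬝ᵥ (S.gram *ᵥ (S.coord *ᵥ x)) + θ ^ 2 * S.gain f ρ x ^ 2

/-- The dissipation form at slope `s`. -/
def dissip (θ s : ℝ) (z : m → ℝ) (v : k → ℝ) : ℝ :=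
  -(z ⬝ᵥ (S.proj *ᵥ z)) + z ⬝ᵥ ((S.V * S.B) *ᵥ v)
    - (2 * θ ^ 2 * s) * (v ⬝ᵥ ((S.G * S.L * S.Vᵀ) *ᵥ z)) - (2 * θ ^ 2 * s) * (v ⬝ᵥ v)

omit [DecidableEq m] in
theorem gram_posDef : S.gram.PosDef := by
  refine .of_dotProduct_mulVec_pos (by simp [gram, IsHermitian]) fun z hz => ?_
  have h : star z ⬝ᵥ (S.gram *ᵥ z) = (S.Vᵀ *ᵥ z) ⬝ᵥ (S.Vᵀ *ᵥ z) := by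
    rw [gram, ← mulVec_mulVec, dotProduct_mulVec, star_trivial, ← mulVec_transpose]
  rw [h]
  refine lt_of_le_of_ne (dotProduct_self_nonneg' _) fun h0 => hz ?_
  exact S.eq_zero_of_transpose z (dotProduct_self_eq_zero.1 h0.symm)

omit [DecidableEq m] in
theorem gram_transpose : S.gramᵀ = S.gram := by simp [gram, transpose_mul]

theorem gram_mul_coord : S.gram * S.coord = S.V := by
  rw [coord, ← Matrix.mul_assoc, Matrix.mul_nonsing_inv _ ((isUnit_iff_isUnit_det _).1
    S.gram_posDef.isUnit), Matrix.one_mul]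

theorem gram_mulVec_coord (x : n → ℝ) : S.gram *ᵥ (S.coord *ᵥ x) = S.V *ᵥ x := by
  rw [mulVec_mulVec, gram_mul_coord]

/-- `x` and its projection `Vᵀ z` differ by an element of the null space of `V`, which `L` also
kills. Hence the drift depends on `z` alone. -/
theorem L_mulVec (x : n → ℝ) : S.L *ᵥ x = S.L *ᵥ (S.Vᵀ *ᵥ (S.coord *ᵥ x)) := by
  have h : S.V *ᵥ (x - S.Vᵀ *ᵥ (S.coord *ᵥ x)) = 0 := by
    rw [mulVec_sub, mulVec_mulVec, ← gram, gram_mulVec_coord, sub_self]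
  rw [S.mulVec_eq_zero_iff, mulVec_sub, sub_eq_zero] at h
  exact h

omit [DecidableEq m] in
-- If the form vanishes at `z`, semidefiniteness puts `Vᵀ z` in the common null space of `L` and
-- `V`; then `V Vᵀ z = 0`, against `gram_posDef`.
theorem proj_posDef : S.proj.PosDef := by
  have hH : S.L.IsHermitian := S.posSemidef.1
  refine .of_dotProduct_mulVec_pos ?_ fun z hz => ?_
  · have := isHermitian_mul_mul_conjTranspose S.V hH
    rwa [conjTranspose_eq_transpose_of_trivial] at this
  · have h : star z ⬝ᵥ (S.proj *ᵥ z) = star (S.Vᵀ *ᵥ z) ⬝ᵥ (S.L *ᵥ (S.Vᵀ *ᵥ z)) := by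
      rw [proj, Matrix.mul_assoc, ← mulVec_mulVec, dotProduct_mulVec, star_trivial, star_trivial,
        ← mulVec_transpose, mulVec_mulVec]
    rw [h]
    refine lt_of_le_of_ne (S.posSemidef.dotProduct_mulVec_nonneg _) fun h0 => hz ?_
    have h1 := (S.posSemidef.dotProduct_mulVec_zero_iff _).1 h0.symm
    rw [← S.mulVec_eq_zero_iff, mulVec_mulVec] at h1
    by_contra hz'
    have := S.gram_posDef.dotProduct_mulVec_pos hz'
    rw [gram, h1] at this
    simp at this

/-- The derivative of the Lyapunov function along a curve. -/
theorem hasDerivWithinAt_energy {f : ℝ → ℝ} (hf : ContDiff ℝ 1 f) (ρ θ : ℝ) {x : ℝ → n → ℝ}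
    {v : n → ℝ} {s : Set ℝ} {t : ℝ} (hx : HasDerivWithinAt x v s t) :
    HasDerivWithinAt (fun τ => S.energy f ρ θ (x τ))
      (2 * ((S.coord *ᵥ x t) ⬝ᵥ (S.V *ᵥ v))
        + 2 * θ ^ 2 * S.gain f ρ (x t)
          * (deriv f (S.sqSide (x t) - ρ) * (2 * ((S.G *ᵥ x t) ⬝ᵥ (S.G *ᵥ v))))) s t := by
  have hz := hx.mulVec_const S.coord
  have hu := hx.mulVec_const S.G
  have h1 := hz.dotProduct (hz.mulVec_const S.gram)
  have hq : HasDerivWithinAt (fun τ => S.sqSide (x τ) - ρ)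
      (2 * ((S.G *ᵥ x t) ⬝ᵥ (S.G *ᵥ v))) s t := by
    refine ((hu.dotProduct hu).sub_const ρ).congr_deriv ?_
    rw [dotProduct_comm (S.G *ᵥ v)]
    ring
  have hfd : HasDerivAt f (deriv f (S.sqSide (x t) - ρ)) (S.sqSide (x t) - ρ) :=
    (hf.differentiable one_ne_zero _).hasDerivAt
  have hg := hfd.comp_hasDerivWithinAt t hq
  have h2 := h1.add ((hg.pow 2).const_mul (θ ^ 2))
  refine HasDerivWithinAt.congr_deriv (f := fun τ => S.energy f ρ θ (x τ)) h2 ?_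
  -- Symmetry of `gram` merges the two halves of the product rule, and `gram * coord = V` removes
  -- the inverse.
  have e1 : (S.coord *ᵥ v) ⬝ᵥ (S.gram *ᵥ (S.coord *ᵥ x t))
      = (S.coord *ᵥ x t) ⬝ᵥ (S.gram *ᵥ (S.coord *ᵥ v)) := by
    rw [dotProduct_mulVec, ← mulVec_transpose, gram_transpose, dotProduct_comm]
  rw [e1, S.gram_mulVec_coord v]
  simp only [gain, Function.comp]
  ring

/-- The gain enters only through `v = φ u`, and the damping `-|v|²` comes from `G * B = -1`. What
remains is a quadratic form with the slope as its single parameter. -/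
theorem energy_deriv_field (f : ℝ → ℝ) (ρ θ : ℝ) (x : n → ℝ) :
    2 * ((S.coord *ᵥ x) ⬝ᵥ (S.V *ᵥ S.field f ρ x))
        + 2 * θ ^ 2 * S.gain f ρ x
          * (deriv f (S.sqSide x - ρ) * (2 * ((S.G *ᵥ x) ⬝ᵥ (S.G *ᵥ S.field f ρ x))))
      = 2 * S.dissip θ (deriv f (S.sqSide x - ρ)) (S.coord *ᵥ x)
          (S.gain f ρ x • (S.G *ᵥ x)) := by
  have h1 : S.V *ᵥ S.field f ρ x = -(S.proj *ᵥ (S.coord *ᵥ x))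
      + S.gain f ρ x • ((S.V * S.B) *ᵥ (S.G *ᵥ x)) := by
    rw [field, S.L_mulVec x, mulVec_add, mulVec_neg, mulVec_smul, proj]
    simp only [mulVec_mulVec, Matrix.mul_assoc]
  have h2 : S.G *ᵥ S.field f ρ x = -((S.G * S.L * S.Vᵀ) *ᵥ (S.coord *ᵥ x))
      - S.gain f ρ x • (S.G *ᵥ x) := by
    rw [field, S.L_mulVec x, mulVec_add, mulVec_neg, mulVec_smul, mulVec_mulVec _ S.G S.B,
      S.G_mul_B, sub_eq_add_neg, neg_mulVec, one_mulVec, smul_neg]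
    simp only [mulVec_mulVec, Matrix.mul_assoc]
  rw [h1, h2, dissip]
  simp only [dotProduct_add, dotProduct_neg, dotProduct_sub, dotProduct_smul, smul_dotProduct,
    mulVec_smul, smul_eq_mul]
  ring

omit [DecidableEq m] in
theorem continuous_dissip (θ : ℝ) :
    Continuous fun q : ℝ × (m → ℝ) × (k → ℝ) => S.dissip θ q.1 q.2.1 q.2.2 := by
  unfold dissip
  fun_prop (disch := skip)

omit [DecidableEq m] in
theorem dissip_smul (θ s r : ℝ) (z : m → ℝ) (v : k → ℝ) :
    S.dissip θ s (r • z) (r • v) = r ^ 2 * S.dissip θ s z v := by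
  simp only [dissip, mulVec_smul, dotProduct_smul, smul_dotProduct, smul_eq_mul]
  ring

end ShapeSystem

/-! ### Negativity of the dissipation and bounds on sublevel sets -/

namespace ShapeSystem

variable {n m k : Type*} [Fintype n] [Fintype m] [Fintype k] [DecidableEq k] [DecidableEq m]
  (S : ShapeSystem n m k)

/-- The Schur-complement condition makes the dissipation form negative definite. -/
theorem dissip_neg_of_schur {θ s : ℝ}
    (h : ((2 * θ ^ 2 * s) • (1 : Matrix k k ℝ)
      - (1 / 4 : ℝ) • (((S.V * S.B)ᵀ - (2 * θ ^ 2 * s) • (S.G * S.L * S.Vᵀ)) * S.proj⁻¹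
        * ((S.V * S.B)ᵀ - (2 * θ ^ 2 * s) • (S.G * S.L * S.Vᵀ))ᵀ)).PosDef)
    {z : m → ℝ} {v : k → ℝ} (hzv : (z, v) ≠ 0) : S.dissip θ s z v < 0 := by
  set a := 2 * θ ^ 2 * s with ha
  set C := (S.V * S.B)ᵀ - a • (S.G * S.L * S.Vᵀ) with hC
  set w := Cᵀ *ᵥ v with hw
  set y := S.proj⁻¹ *ᵥ w with hy
  have hQ : S.projᵀ = S.proj := by
    have := S.proj_posDef.1
    rwa [IsHermitian, conjTranspose_eq_transpose_of_trivial] at this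
  have hQy : S.proj *ᵥ y = w := by
    rw [hy, mulVec_mulVec, Matrix.mul_nonsing_inv _ ((isUnit_iff_isUnit_det _).1
      S.proj_posDef.isUnit), one_mulVec]
  have hyz : ∀ z, y ⬝ᵥ (S.proj *ᵥ z) = w ⬝ᵥ z := fun z => by
    rw [dotProduct_mulVec, ← mulVec_transpose, hQ, hQy]
  have hzw : z ⬝ᵥ w = z ⬝ᵥ ((S.V * S.B) *ᵥ v) - a * (v ⬝ᵥ ((S.G * S.L * S.Vᵀ) *ᵥ z)) := by
    rw [hw, hC, transpose_sub, transpose_transpose, transpose_smul, sub_mulVec, dotProduct_sub,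
      smul_mulVec, dotProduct_smul, smul_eq_mul, mulVec_transpose, dotProduct_comm z (_ ᵥ* _),
      ← dotProduct_mulVec]
  have hM : v ⬝ᵥ ((a • (1 : Matrix k k ℝ) - (1 / 4 : ℝ) • (C * S.proj⁻¹ * Cᵀ)) *ᵥ v)
      = a * (v ⬝ᵥ v) - 1 / 4 * (w ⬝ᵥ y) := by
    rw [sub_mulVec, dotProduct_sub, smul_mulVec, smul_mulVec, one_mulVec, dotProduct_smul,
      dotProduct_smul, smul_eq_mul, smul_eq_mul, Matrix.mul_assoc, ← mulVec_mulVec,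
      dotProduct_mulVec, ← mulVec_transpose, ← mulVec_mulVec]
  -- For fixed `v` the maximum over `z` is at `y / 2`; completing the square there leaves minus the
  -- Schur complement in `v`.
  have key : S.dissip θ s z v
      = -((z - (1 / 2 : ℝ) • y) ⬝ᵥ (S.proj *ᵥ (z - (1 / 2 : ℝ) • y)))
        - v ⬝ᵥ ((a • (1 : Matrix k k ℝ) - (1 / 4 : ℝ) • (C * S.proj⁻¹ * Cᵀ)) *ᵥ v) := by
    rw [hM, dissip, ← ha]
    simp only [mulVec_sub, mulVec_smul, dotProduct_sub, sub_dotProduct, dotProduct_smul,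
      smul_dotProduct, smul_eq_mul, hQy, hyz, dotProduct_comm w z, dotProduct_comm w y]
    rw [hzw]
    ring
  rw [key]
  by_cases hv : v = 0
  · have hz : z ≠ 0 := fun hz => hzv (by simp [hz, hv])
    have hy0 : y = 0 := by simp [hy, hw, hv]
    have := S.proj_posDef.dotProduct_mulVec_pos hz
    simp only [star_trivial] at this
    simp only [hv, hy0, smul_zero, sub_zero, mulVec_zero, dotProduct_zero]
    linarith
  · have h1 := h.dotProduct_mulVec_pos hv
    have h2 := S.proj_posDef.posSemidef.dotProduct_mulVec_nonneg (z - (1 / 2 : ℝ) • y)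
    simp only [star_trivial] at h1 h2
    linarith

omit [DecidableEq m] in
/-- The slopes at which the dissipation form is negative definite are bounded away from zero. -/
theorem exists_slope_bound (θ : ℝ) :
    ∃ σ : ℝ, 0 < σ ∧ ∀ s : ℝ, 0 < s →
      (∀ (z : m → ℝ) (v : k → ℝ), (z, v) ≠ 0 → S.dissip θ s z v < 0) → σ ≤ s := by
  obtain ⟨v, hv⟩ : ∃ v, (S.V * S.B) *ᵥ v ≠ 0 := by
    by_contra! hall
    exact S.V_mul_B_ne_zero (ext_of_mulVec_single fun i => by rw [hall, zero_mulVec])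
  have hv0 : v ≠ 0 := fun h => hv (by simp [h])
  set b := (S.V * S.B) *ᵥ v with hb
  have hbb : 0 < b ⬝ᵥ b := lt_of_le_of_ne (dotProduct_self_nonneg' b)
    fun h0 => hv (dotProduct_self_eq_zero.1 h0.symm)
  have hbQ : 0 < b ⬝ᵥ (S.proj *ᵥ b) := by
    simpa using S.proj_posDef.dotProduct_mulVec_pos hv
  -- At slope zero the cross term is not balanced by any `v ⬝ᵥ v` term. This `ε` maximises `ε (b ⬝ᵥ
  -- b) - ε² (b ⬝ᵥ proj b)`, so the form is positive at `(ε b, v)` for `s = 0` and can be negative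
  -- only once `s κ` exceeds that value.
  set ε := (b ⬝ᵥ b) / (2 * (b ⬝ᵥ (S.proj *ᵥ b))) with hε
  have hεpos : 0 < ε := by positivity
  set κ := 2 * θ ^ 2 * (v ⬝ᵥ ((S.G * S.L * S.Vᵀ) *ᵥ (ε • b)) + v ⬝ᵥ v) with hκ
  have hform : ∀ s, S.dissip θ s (ε • b) v = (b ⬝ᵥ b) * ε / 2 - s * κ := fun s => by
    have : ε * (b ⬝ᵥ (S.proj *ᵥ b)) = (b ⬝ᵥ b) / 2 := by rw [hε]; field_simp
    rw [dissip, ← hb, hκ, mulVec_smul, mulVec_smul]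
    simp only [dotProduct_smul, smul_dotProduct, smul_eq_mul]
    linear_combination (-ε) * this
  refine ⟨(b ⬝ᵥ b) * ε / 2 / (|κ| + 1), by positivity, fun s hs h => ?_⟩
  have h1 := h (ε • b) v (fun h => hv0 (Prod.ext_iff.1 h).2)
  rw [hform] at h1
  rw [div_le_iff₀ (by positivity)]
  nlinarith [le_abs_self κ]

omit [DecidableEq m] in
theorem exists_gram_bound : ∃ κ : ℝ, 0 < κ ∧ ∀ z : m → ℝ, z ⬝ᵥ (S.gram *ᵥ z) ≤ κ * (z ⬝ᵥ z) := by
  -- No slope is involved here, so the parameter set is a dummy singleton.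
  obtain ⟨c, hc, h⟩ := exists_pos_forall_le_neg_mul_of_homogeneous (E := m → ℝ) (K := {(0 : ℝ)})
    isCompact_singleton (w := fun _ z => -(z ⬝ᵥ z)) (by fun_prop)
    (fun s r e => by simp only [dotProduct_smul, smul_dotProduct, smul_eq_mul]; ring)
    (g := fun z => z ⬝ᵥ (S.gram *ᵥ z)) (by fun_prop)
    (fun r e => by simp only [mulVec_smul, dotProduct_smul, smul_dotProduct, smul_eq_mul]; ring)
    (fun s _ e he => neg_lt_zero.2 (lt_of_le_of_ne (dotProduct_self_nonneg' e)
      fun h0 => he (dotProduct_self_eq_zero.1 h0.symm)))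
  refine ⟨c⁻¹, inv_pos.2 hc, fun z => ?_⟩
  have := h 0 rfl z
  rw [inv_mul_eq_div, le_div_iff₀ hc]
  linarith

omit [DecidableEq m] in
theorem exists_gram_lower_bound :
    ∃ c : ℝ, 0 < c ∧ ∀ z : m → ℝ, c * (z ⬝ᵥ z) ≤ z ⬝ᵥ (S.gram *ᵥ z) := by
  obtain ⟨c, hc, h⟩ := exists_pos_forall_le_neg_mul_of_homogeneous (E := m → ℝ) (K := {(0 : ℝ)})
    isCompact_singleton (w := fun _ z => -(z ⬝ᵥ (S.gram *ᵥ z))) (by fun_prop)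
    (fun s r e => by
      simp only [mulVec_smul, dotProduct_smul, smul_dotProduct, smul_eq_mul]; ring)
    (g := fun z => z ⬝ᵥ z) (by fun_prop)
    (fun r e => by simp only [dotProduct_smul, smul_dotProduct, smul_eq_mul]; ring)
    (fun s _ e he => by
      have := S.gram_posDef.dotProduct_mulVec_pos he
      simp only [star_trivial] at this
      linarith)
  refine ⟨c, hc, fun z => ?_⟩
  have := h 0 rfl z
  linarith

omit [DecidableEq m] in
theorem gram_form_nonneg (z : m → ℝ) : 0 ≤ z ⬝ᵥ (S.gram *ᵥ z) := by
  simpa using S.gram_posDef.posSemidef.dotProduct_mulVec_nonneg z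

theorem energy_nonneg (f : ℝ → ℝ) (ρ θ : ℝ) (x : n → ℝ) : 0 ≤ S.energy f ρ θ x :=
  add_nonneg (S.gram_form_nonneg _) (by positivity)

theorem gain_sq_le_energy (f : ℝ → ℝ) (ρ θ : ℝ) (x : n → ℝ) :
    θ ^ 2 * S.gain f ρ x ^ 2 ≤ S.energy f ρ θ x :=
  le_add_of_nonneg_left (S.gram_form_nonneg _)

omit [DecidableEq m] in
theorem sqSide_nonneg (x : n → ℝ) : 0 ≤ S.sqSide x := dotProduct_self_nonneg' _

/-- Negativity of the auxiliary Jacobian at a state makes the Lyapunov function decay there. -/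
theorem exists_rate_of_dissip_le {c : ℝ} (hc : 0 < c) (f : ℝ → ℝ) (ρ θ : ℝ) :
    ∃ r : ℝ, 0 < r ∧ ∀ x s v, S.dissip θ s (S.coord *ᵥ x) v
        ≤ -c * ((S.coord *ᵥ x) ⬝ᵥ (S.coord *ᵥ x) + (θ * S.gain f ρ x) ^ 2) →
      2 * S.dissip θ s (S.coord *ᵥ x) v ≤ -r * S.energy f ρ θ x := by
  obtain ⟨κ, hκ, hgram⟩ := S.exists_gram_bound
  refine ⟨c / (κ + 1), by positivity, fun x s v h => ?_⟩
  have h1 := hgram (S.coord *ᵥ x)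
  have h0 := dotProduct_self_nonneg' (S.coord *ᵥ x)
  set A := (S.coord *ᵥ x) ⬝ᵥ (S.coord *ᵥ x)
  have hg0 : 0 ≤ (θ * S.gain f ρ x) ^ 2 := sq_nonneg _
  have h2 : S.energy f ρ θ x ≤ (κ + 1) * (A + (θ * S.gain f ρ x) ^ 2) := by
    rw [energy, ← mul_pow]
    nlinarith
  have h3 : c / (κ + 1) * S.energy f ρ θ x ≤ c * (A + (θ * S.gain f ρ x) ^ 2) := by
    rw [div_mul_eq_mul_div, div_le_iff₀ (by positivity)]
    nlinarith
  nlinarith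

section SchurRegime

variable {f : ℝ → ℝ} {ρ θ : ℝ}

omit [DecidableEq m] in
/-- Under negative definite dissipation the gain grows at least linearly. -/
theorem exists_linear_growth (hf : ContDiff ℝ 1 f) (hf0 : f 0 = 0) (hρ : 0 < ρ)
    (hf' : ∀ p : ℝ, -ρ ≤ p → 0 < deriv f p)
    (hneg : ∀ p : ℝ, -ρ ≤ p → ∀ (z : m → ℝ) (v : k → ℝ), (z, v) ≠ 0 →
      S.dissip θ (deriv f p) z v < 0) :
    ∃ σ : ℝ, 0 < σ ∧ ∀ p, 0 ≤ p → σ * p ≤ f p := by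
  obtain ⟨σ, hσ, h⟩ := S.exists_slope_bound θ
  refine ⟨σ, hσ, fun p hp => ?_⟩
  have hd : Differentiable ℝ f := hf.differentiable one_ne_zero
  have := (convex_Ici (0 : ℝ)).mul_sub_le_image_sub_of_le_deriv (f := f)
    hd.continuous.continuousOn hd.differentiableOn (C := σ)
    (fun x hx => by
      rw [interior_Ici] at hx
      have hx' : -ρ ≤ x := by have : (0 : ℝ) < x := hx; linarith
      exact h _ (hf' x hx') (hneg x hx')) 0 (by simp) p (by simpa using hp) hp
  simpa [hf0] using this

/-- By the linear growth of `f`, a squared side beyond `ρ + √η / (θ σ)` would force `θ φ > √η`. -/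
theorem exists_sqSide_bound (hf : ContDiff ℝ 1 f) (hf0 : f 0 = 0) (hρ : 0 < ρ)
    (hf' : ∀ p : ℝ, -ρ ≤ p → 0 < deriv f p) (hθ : 0 < θ)
    (hneg : ∀ p : ℝ, -ρ ≤ p → ∀ (z : m → ℝ) (v : k → ℝ), (z, v) ≠ 0 →
      S.dissip θ (deriv f p) z v < 0) (η : ℝ) :
    ∃ Q : ℝ, 0 < Q ∧ ∀ x, S.energy f ρ θ x ≤ η → S.sqSide x ≤ Q := by
  obtain ⟨σ, hσ, h⟩ := S.exists_linear_growth hf hf0 hρ hf' hneg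
  refine ⟨ρ + √η / (θ * σ), by positivity, fun x hx => ?_⟩
  by_contra! hlt
  have hp : 0 ≤ S.sqSide x - ρ := by
    have : 0 ≤ √η / (θ * σ) := by positivity
    linarith
  have h1 : √η < (S.sqSide x - ρ) * (θ * σ) := by
    rw [← div_lt_iff₀ (by positivity)]; linarith
  have h2 : √η < θ * S.gain f ρ x := by
    have := mul_le_mul_of_nonneg_left (h _ hp) hθ.le
    unfold gain
    nlinarith
  have h3 : η < (θ * S.gain f ρ x) ^ 2 := Real.lt_sq_of_sqrt_lt h2
  have h4 := S.gain_sq_le_energy f ρ θ x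
  rw [mul_pow] at h3
  linarith

/-- Dissipation on sublevel sets of the Lyapunov function. -/
theorem exists_dissip_bound (hf : ContDiff ℝ 1 f) (hf0 : f 0 = 0) (hρ : 0 < ρ)
    (hf' : ∀ p : ℝ, -ρ ≤ p → 0 < deriv f p) (hθ : 0 < θ)
    (hneg : ∀ p : ℝ, -ρ ≤ p → ∀ (z : m → ℝ) (v : k → ℝ), (z, v) ≠ 0 →
      S.dissip θ (deriv f p) z v < 0) (η : ℝ) :
    ∃ c : ℝ, 0 < c ∧ ∀ x, S.energy f ρ θ x ≤ η →
      2 * S.dissip θ (deriv f (S.sqSide x - ρ)) (S.coord *ᵥ x) (S.gain f ρ x • (S.G *ᵥ x))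
        ≤ -c * ((S.coord *ᵥ x) ⬝ᵥ (S.coord *ᵥ x) + S.gain f ρ x ^ 2 * S.sqSide x) := by
  obtain ⟨Q, hQ, hside⟩ := S.exists_sqSide_bound hf hf0 hρ hf' hθ hneg η
  have hcont : Continuous (deriv f) := hf.continuous_deriv le_rfl
  -- On the sublevel set the argument of `f` stays in `[-ρ, Q - ρ]`, so only a compact set of slopes
  -- occurs and the negativity is uniform.
  have hK : IsCompact (deriv f '' Set.Icc (-ρ) (Q - ρ)) := isCompact_Icc.image hcont
  obtain ⟨c, hc, h⟩ := exists_pos_forall_le_neg_mul_of_homogeneous (E := (m → ℝ) × (k → ℝ)) hK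
    (w := fun s e => S.dissip θ s e.1 e.2) (S.continuous_dissip θ)
    (fun s r e => S.dissip_smul θ s r e.1 e.2)
    (g := fun e => e.1 ⬝ᵥ e.1 + e.2 ⬝ᵥ e.2) (by fun_prop)
    (fun r e => by
      simp only [Prod.smul_fst, Prod.smul_snd, dotProduct_smul, smul_dotProduct, smul_eq_mul]
      ring)
    (by
      rintro _ ⟨p, hp, rfl⟩ e he
      exact hneg p hp.1 e.1 e.2 he)
  refine ⟨2 * c, by positivity, fun x hx => ?_⟩
  have h1 := h (deriv f (S.sqSide x - ρ))
    ⟨_, ⟨by linarith [S.sqSide_nonneg x], by linarith [hside x hx]⟩, rfl⟩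
    (S.coord *ᵥ x, S.gain f ρ x • (S.G *ᵥ x))
  simp only [dotProduct_smul, smul_dotProduct, smul_eq_mul] at h1
  simp only [sqSide] at h1 ⊢
  linarith

/-- Exponential dissipation on the sublevel sets that exclude a vanishing side. -/
theorem exists_rate_of_lt (hf : ContDiff ℝ 1 f) (hf0 : f 0 = 0) (hρ : 0 < ρ)
    (hf' : ∀ p : ℝ, -ρ ≤ p → 0 < deriv f p) (hθ : 0 < θ)
    (hneg : ∀ p : ℝ, -ρ ≤ p → ∀ (z : m → ℝ) (v : k → ℝ), (z, v) ≠ 0 →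
      S.dissip θ (deriv f p) z v < 0) {η : ℝ} (hη : η < θ ^ 2 * f (-ρ) ^ 2) :
    ∃ r : ℝ, 0 < r ∧ ∀ x, S.energy f ρ θ x ≤ η →
      2 * S.dissip θ (deriv f (S.sqSide x - ρ)) (S.coord *ᵥ x) (S.gain f ρ x • (S.G *ᵥ x))
        ≤ -r * S.energy f ρ θ x := by
  obtain ⟨c, hc, h⟩ := S.exists_dissip_bound hf hf0 hρ hf' hθ hneg η
  obtain ⟨κ, hκ, hgram⟩ := S.exists_gram_bound
  have hcf : Continuous fun p => θ ^ 2 * f p ^ 2 := by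
    have := hf.continuous
    fun_prop
  -- By continuity at `-ρ`, a squared side below `δ` would give an energy above `η`. The two terms
  -- of the minimum below then absorb the shape part and the gain part of the energy.
  obtain ⟨δ, hδ, hball⟩ := Metric.eventually_nhds_iff.1
    ((hcf.tendsto (-ρ)).eventually (lt_mem_nhds hη))
  refine ⟨min (c / κ) (c * δ / θ ^ 2), by positivity, fun x hx => ?_⟩
  have hside : δ ≤ S.sqSide x := by
    by_contra! hlt
    have h1 := hball (y := S.sqSide x - ρ) (by
      rw [Real.dist_eq, abs_lt]
      constructor <;> linarith [S.sqSide_nonneg x])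
    have h2 := S.gain_sq_le_energy f ρ θ x
    unfold gain at h2
    linarith
  refine (h x hx).trans ?_
  have h1 := hgram (S.coord *ᵥ x)
  have h0 := dotProduct_self_nonneg' (S.coord *ᵥ x)
  set A := (S.coord *ᵥ x) ⬝ᵥ (S.coord *ᵥ x)
  set r := min (c / κ) (c * δ / θ ^ 2)
  have hr1 : r * κ ≤ c := by
    rw [← le_div_iff₀ hκ]; exact min_le_left _ _
  have hr2 : r * θ ^ 2 ≤ c * δ := by
    rw [← le_div_iff₀ (by positivity)]; exact min_le_right _ _
  have hr0 : 0 ≤ r := by positivity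
  rw [energy]
  have e1 : r * ((S.coord *ᵥ x) ⬝ᵥ (S.gram *ᵥ (S.coord *ᵥ x))) ≤ c * A := by
    nlinarith
  have e2 : r * (θ ^ 2 * S.gain f ρ x ^ 2) ≤ c * (S.gain f ρ x ^ 2 * S.sqSide x) := by
    have := sq_nonneg (S.gain f ρ x)
    have h5 : c * (S.gain f ρ x ^ 2 * δ) ≤ c * (S.gain f ρ x ^ 2 * S.sqSide x) := by gcongr
    nlinarith
  linarith

/-- Dissipation where the Lyapunov function is at least its value at the collapsed states. -/
theorem exists_dissip_bound_of_ge (hf : ContDiff ℝ 1 f) (hf0 : f 0 = 0) (hρ : 0 < ρ)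
    (hf' : ∀ p : ℝ, -ρ ≤ p → 0 < deriv f p) (hθ : 0 < θ)
    (hneg : ∀ p : ℝ, -ρ ≤ p → ∀ (z : m → ℝ) (v : k → ℝ), (z, v) ≠ 0 →
      S.dissip θ (deriv f p) z v < 0) {η₀ : ℝ} (hη₀ : 0 < η₀) (η : ℝ) :
    ∃ c : ℝ, 0 < c ∧ ∀ x, η₀ ≤ S.energy f ρ θ x → S.energy f ρ θ x ≤ η →
      2 * S.dissip θ (deriv f (S.sqSide x - ρ)) (S.coord *ᵥ x) (S.gain f ρ x • (S.G *ᵥ x))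
        ≤ -c * ((S.coord *ᵥ x) ⬝ᵥ (S.coord *ᵥ x) + S.sqSide x) := by
  obtain ⟨c, hc, h⟩ := S.exists_dissip_bound hf hf0 hρ hf' hθ hneg η
  obtain ⟨Q, hQ, hside⟩ := S.exists_sqSide_bound hf hf0 hρ hf' hθ hneg η
  obtain ⟨κ, hκ, hgram⟩ := S.exists_gram_bound
  -- One of the two parts of the energy is at least `η₀ / 2`. If it is the gain part, then `φ² ≥ μ`;
  -- otherwise `A ≥ 2 μ Q`, half of which dominates `μ` times the squared side while the other half
  -- dominates `μ A`.
  set μ := min (1 / 2) (min (η₀ / (2 * θ ^ 2)) (η₀ / (4 * κ * Q)))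
  have hμ : 0 < μ := by positivity
  refine ⟨c * μ, by positivity, fun x hx0 hx => (h x hx).trans ?_⟩
  have h1 := hgram (S.coord *ᵥ x)
  have h0 := dotProduct_self_nonneg' (S.coord *ᵥ x)
  have hE : (S.coord *ᵥ x) ⬝ᵥ (S.gram *ᵥ (S.coord *ᵥ x)) + θ ^ 2 * S.gain f ρ x ^ 2
    = S.energy f ρ θ x := rfl
  set A := (S.coord *ᵥ x) ⬝ᵥ (S.coord *ᵥ x)
  have hq := S.sqSide_nonneg x
  have hqQ := hside x hx
  have hg := sq_nonneg (S.gain f ρ x)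
  have hμ1 : μ ≤ 1 / 2 := min_le_left _ _
  have hμ2 : μ * (2 * θ ^ 2) ≤ η₀ := by
    rw [← le_div_iff₀ (by positivity)]
    exact (min_le_right _ _).trans (min_le_left _ _)
  have hμ3 : μ * (4 * κ * Q) ≤ η₀ := by
    rw [← le_div_iff₀ (by positivity)]
    exact (min_le_right _ _).trans (min_le_right _ _)
  suffices hs : μ * (A + S.sqSide x) ≤ A + S.gain f ρ x ^ 2 * S.sqSide x by
    have := mul_le_mul_of_nonneg_left hs hc.le
    linarith
  rcases le_total (η₀ / 2) (θ ^ 2 * S.gain f ρ x ^ 2) with hcase | hcase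
  · have h2 : μ ≤ S.gain f ρ x ^ 2 := by
      have : 0 < θ ^ 2 := by positivity
      nlinarith
    nlinarith [mul_le_mul_of_nonneg_right h2 hq]
  · have h2 : η₀ / 2 ≤ κ * A := by linarith
    have h3 : μ * Q * 2 ≤ A := by
      nlinarith
    have h4 : μ * S.sqSide x ≤ μ * Q := by gcongr
    have h5 : 0 ≤ S.gain f ρ x ^ 2 * S.sqSide x := by positivity
    nlinarith

end SchurRegime

end ShapeSystem

/-! ### Decay estimates, a Barbalat lemma and global solutions -/

theorem antitoneOn_Ici_of_hasDerivWithinAt {y y' : ℝ → ℝ} {a b : ℝ} (hab : a ≤ b)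
    (hy : ∀ t, a ≤ t → HasDerivWithinAt y (y' t) (Set.Ici a) t) (hneg : ∀ t, b ≤ t → y' t ≤ 0) :
    AntitoneOn y (Set.Ici b) := by
  refine antitoneOn_of_hasDerivWithinAt_nonpos (f' := y') (convex_Ici b)
    (fun t ht => ((hy t (hab.trans ht)).mono (Set.Ici_subset_Ici.2 hab)).continuousWithinAt)
    (fun t ht => ?_) (fun t ht => ?_)
  · have := interior_subset ht
    exact (hy t (hab.trans this)).mono
      (interior_subset.trans (Set.Ici_subset_Ici.2 hab))
  · exact hneg t (interior_subset ht)

/-- Exponential decay from a linear differential inequality. -/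
theorem le_mul_exp_of_deriv_le {y y' : ℝ → ℝ} {r b : ℝ} (hb : 0 ≤ b)
    (hy : ∀ t, 0 ≤ t → HasDerivWithinAt y (y' t) (Set.Ici 0) t)
    (hle : ∀ t, b ≤ t → y' t ≤ -r * y t) {t : ℝ} (ht : b ≤ t) :
    y t ≤ y b * Real.exp (-(r * (t - b))) := by
  have hE : ∀ t : ℝ, HasDerivAt (fun t => Real.exp (r * t)) (Real.exp (r * t) * r) t := fun t => by
    simpa using ((hasDerivAt_id t).const_mul r).exp
  have h := antitoneOn_Ici_of_hasDerivWithinAt hb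
    (y := fun t => y t * Real.exp (r * t))
    (fun t ht => (hy t ht).mul (hE t).hasDerivWithinAt)
    (fun t ht => by
      have := mul_le_mul_of_nonneg_right (hle t ht) (Real.exp_pos (r * t)).le
      linarith) (Set.self_mem_Ici) ht ht
  have e : Real.exp (-(r * (t - b))) = Real.exp (r * b) / Real.exp (r * t) := by
    rw [← Real.exp_sub]; congr 1; ring
  rw [e, ← mul_div_assoc, le_div_iff₀ (Real.exp_pos _)]
  exact h

/-- A nonincreasing function bounded below has a limit, shared by its shifts; composing with `max t
0` makes it antitone on the whole line. -/
theorem tendsto_sub_shift_of_antitoneOn {y : ℝ → ℝ} (hanti : AntitoneOn y (Set.Ici 0))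
    (hpos : ∀ t, 0 ≤ t → 0 ≤ y t) {δ : ℝ} (hδ : 0 ≤ δ) :
    Tendsto (fun t => y t - y (t + δ)) atTop (𝓝 0) := by
  have hanti' : Antitone fun t => y (max t 0) := fun s t hst =>
    hanti (Set.mem_Ici.2 (le_max_right _ _)) (Set.mem_Ici.2 (le_max_right _ _))
      (max_le_max hst le_rfl)
  have hlim := tendsto_atTop_ciInf hanti' ⟨0, by rintro _ ⟨t, rfl⟩; exact hpos _ (le_max_right _ _)⟩
  have h2 := hlim.sub (hlim.comp (tendsto_atTop_add_const_right atTop δ tendsto_id))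
  rw [sub_self] at h2
  refine h2.congr' ?_
  filter_upwards [eventually_ge_atTop 0] with t ht
  simp [max_eq_left ht, max_eq_left (add_nonneg ht hδ)]

/-- A form of **Barbalat's lemma**: a Lipschitz dissipation rate tends to zero. -/
theorem tendsto_zero_of_dissipation {y y' g : ℝ → ℝ} {c K : ℝ} (hc : 0 < c) (hK : 0 ≤ K)
    (hy : ∀ t, 0 ≤ t → HasDerivWithinAt y (y' t) (Set.Ici 0) t)
    (hpos : ∀ t, 0 ≤ t → 0 ≤ y t) (hg0 : ∀ t, 0 ≤ t → 0 ≤ g t)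
    (hle : ∀ t, 0 ≤ t → y' t ≤ -c * g t)
    (hg : ∀ s t, 0 ≤ s → s ≤ t → g s - K * (t - s) ≤ g t) :
    Tendsto g atTop (𝓝 0) := by
  have hanti : AntitoneOn y (Set.Ici 0) := antitoneOn_Ici_of_hasDerivWithinAt le_rfl hy
    fun t ht => (hle t ht).trans (by nlinarith [hg0 t ht])
  -- On `[t, t + δ]` the rate stays above `g t - K δ`, so `y` drops there by at least `c δ (g t - K
  -- δ)`.
  have key : ∀ δ, 0 < δ → ∀ t, 0 ≤ t → g t ≤ K * δ + (y t - y (t + δ)) / (c * δ) := by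
    intro δ hδ t ht
    have h1 := antitoneOn_of_hasDerivWithinAt_nonpos (D := Set.Icc t (t + δ))
      (f := fun s => y s + c * (g t - K * δ) * s) (f' := fun s => y' s + c * (g t - K * δ))
      (convex_Icc _ _)
      (fun s hs => by
        have hs0 : 0 ≤ s := ht.trans hs.1
        have hsub : Set.Icc t (t + δ) ⊆ Set.Ici 0 := fun q hq => ht.trans hq.1
        exact (((hy s hs0).continuousWithinAt.mono hsub).add (by fun_prop)))
      (fun s hs => by
        have hs' := interior_subset hs
        have hs0 : 0 ≤ s := ht.trans hs'.1
        have hsub : interior (Set.Icc t (t + δ)) ⊆ Set.Ici 0 := fun q hq =>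
          ht.trans (interior_subset hq).1
        have h2 := ((hasDerivAt_id s).const_mul (c * (g t - K * δ))).hasDerivWithinAt
          (s := interior (Set.Icc t (t + δ)))
        rw [mul_one] at h2
        exact ((hy s hs0).mono hsub).add h2)
      (fun s hs => by
        have hs' := interior_subset hs
        have h2 := hle s (ht.trans hs'.1)
        have h3 := hg t s ht hs'.1
        have h4 : K * (s - t) ≤ K * δ := mul_le_mul_of_nonneg_left (by linarith [hs'.2]) hK
        have h5 : c * (g t - K * δ) ≤ c * g s := mul_le_mul_of_nonneg_left (by linarith) hc.le
        linarith)
      (Set.left_mem_Icc.2 (by linarith)) (Set.right_mem_Icc.2 (by linarith)) (by linarith)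
    simp only at h1
    have h2 : (g t - K * δ) * (c * δ) ≤ y t - y (t + δ) := by linarith
    rw [← le_div_iff₀ (by positivity)] at h2
    linarith
  rw [Metric.tendsto_atTop]
  intro ε hε
  set δ := ε / (2 * (K + 1)) with hδ
  have hδpos : 0 < δ := by positivity
  have hKδ : K * δ ≤ ε / 2 := by
    rw [hδ, mul_div_assoc', div_le_div_iff₀ (by positivity) (by positivity)]
    nlinarith
  have hsh := (tendsto_sub_shift_of_antitoneOn hanti hpos hδpos.le).eventually
    (gt_mem_nhds (show (0 : ℝ) < ε / 2 * (c * δ) by positivity))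
  obtain ⟨T, hT⟩ := (hsh.and (eventually_ge_atTop 0)).exists_forall_of_atTop
  refine ⟨T, fun t ht => ?_⟩
  obtain ⟨h1, h2⟩ := hT t ht
  rw [Real.dist_eq, sub_zero, abs_of_nonneg (hg0 t h2)]
  have h3 := key δ hδpos t h2
  rw [← div_lt_iff₀ (by positivity)] at h1
  linarith

/-- A curve whose velocity decays exponentially converges exponentially. -/
theorem exists_limit_of_deriv_le_exp {E : Type*} [NormedAddCommGroup E] [NormedSpace ℝ E]
    [CompleteSpace E] {x x' : ℝ → E} {C r : ℝ} (hr : 0 < r)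
    (hx : ∀ t, 0 ≤ t → HasDerivWithinAt x (x' t) (Set.Ici 0) t)
    (hle : ∀ t, 0 ≤ t → ‖x' t‖ ≤ C * Real.exp (-(r * t))) :
    ∃ z, ∀ t, 0 ≤ t → ‖x t - z‖ ≤ C / r * Real.exp (-(r * t)) := by
  have hC : 0 ≤ C := by
    have := (norm_nonneg _).trans (hle 0 le_rfl)
    simpa using this
  have key : ∀ s t, 0 ≤ s → s ≤ t → ‖x t - x s‖ ≤ C / r * Real.exp (-(r * s)) := by
    intro s t hs hst
    have hB : ∀ τ : ℝ, HasDerivAt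
        (fun τ => C / r * (Real.exp (-(r * s)) - Real.exp (-(r * τ))))
        (C * Real.exp (-(r * τ))) τ := fun τ => by
      have h1 := ((((hasDerivAt_id τ).const_mul r).neg.exp).const_sub
        (Real.exp (-(r * s)))).const_mul (C / r)
      refine h1.congr_deriv ?_
      simp only [id, Pi.neg_apply]
      field_simp
    have h := image_norm_le_of_norm_deriv_right_le_deriv_boundary (a := s) (b := t)
      (f := fun τ => x τ - x s) (f' := x')
      (fun τ hτ => (((hx τ (hs.trans hτ.1)).continuousWithinAt.mono
        (fun q hq => hs.trans hq.1)).sub continuousWithinAt_const))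
      (fun τ hτ => ((hx τ (hs.trans hτ.1)).mono
        (Set.Ici_subset_Ici.2 (hs.trans hτ.1))).sub_const _)
      (by simp) hB (fun τ hτ => hle τ (hs.trans hτ.1)) (Set.right_mem_Icc.2 hst)
    refine h.trans ?_
    have : 0 ≤ Real.exp (-(r * t)) := (Real.exp_pos _).le
    gcongr
    linarith
  have hexp : Tendsto (fun t : ℝ => C / r * Real.exp (-(r * t))) atTop (𝓝 0) := by
    have h1 : Tendsto (fun t : ℝ => r * t) atTop atTop := tendsto_id.const_mul_atTop hr
    simpa using (Real.tendsto_exp_neg_atTop_nhds_zero.comp h1).const_mul (C / r)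
  have hcauchy : Cauchy (map x atTop) := by
    rw [Metric.cauchy_iff]
    refine ⟨inferInstance, fun ε hε => ?_⟩
    obtain ⟨T, hT⟩ := ((hexp.eventually (gt_mem_nhds (half_pos hε))).and
      (eventually_ge_atTop 0)).exists
    refine ⟨x '' Set.Ici T, image_mem_map (Ici_mem_atTop T), ?_⟩
    rintro _ ⟨a, ha, rfl⟩ _ ⟨b, hb, rfl⟩
    have h1 := key T a hT.2 ha
    have h2 := key T b hT.2 hb
    rw [← dist_eq_norm] at h1 h2
    linarith [dist_triangle_right (x a) (x b) (x T), hT.1]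
  obtain ⟨z, hz⟩ := CompleteSpace.complete hcauchy
  refine ⟨z, fun t ht => ?_⟩
  have h1 : Tendsto (fun τ => ‖x t - x τ‖) atTop (𝓝 ‖x t - z‖) :=
    (tendsto_const_nhds.sub hz).norm
  refine le_of_tendsto h1 ?_
  filter_upwards [eventually_ge_atTop t] with τ hτ
  rw [norm_sub_rev]
  exact key t τ ht hτ

/-- The bound `M` confines the curve to a ball of radius `M T`, on which the global Lipschitz
constant is available, so one Picard–Lindelöf step reaches time `T`. -/
theorem exists_solution_Icc {E : Type*} [NormedAddCommGroup E] [NormedSpace ℝ E]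
    [CompleteSpace E] {F : E → E} {K : NNReal} (hF : LipschitzWith K F) {M : NNReal}
    (hM : ∀ x, ‖F x‖ ≤ M) (x₀ : E) {T : ℝ} (hT : 0 ≤ T) :
    ∃ x : ℝ → E, x 0 = x₀ ∧
      ∀ t ∈ Set.Icc 0 T, HasDerivWithinAt x (F (x t)) (Set.Icc 0 T) t := by
  have hpl : IsPicardLindelof (fun _ => F) (tmin := 0) (tmax := T)
      ⟨0, Set.left_mem_Icc.2 hT⟩ x₀ (M * T.toNNReal) 0 M K :=
    IsPicardLindelof.of_time_independent (fun x _ => hM x) hF.lipschitzOnWith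
      (by simp [max_eq_left hT, Real.coe_toNNReal T hT])
  exact hpl.exists_eq_forall_mem_Icc_hasDerivWithinAt
    (Metric.mem_closedBall_self (NNReal.coe_nonneg _))

/-- Global forward solutions of a bounded Lipschitz vector field. -/
theorem exists_forward_solution {E : Type*} [NormedAddCommGroup E] [NormedSpace ℝ E]
    [CompleteSpace E] {F : E → E} {K : NNReal} (hF : LipschitzWith K F) {M : NNReal}
    (hM : ∀ x, ‖F x‖ ≤ M) (x₀ : E) :
    ∃ x : ℝ → E, x 0 = x₀ ∧ ∀ t, 0 ≤ t → HasDerivWithinAt x (F (x t)) (Set.Ici 0) t := by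
  have hloc : ∀ j : ℕ, ∃ x : ℝ → E, x 0 = x₀ ∧
      ∀ t ∈ Set.Icc (0 : ℝ) (j + 1), HasDerivWithinAt x (F (x t)) (Set.Icc 0 (j + 1)) t :=
    fun j => exists_solution_Icc hF hM x₀ (by positivity)
  choose y hy0 hy using hloc
  -- Solutions on different intervals agree by uniqueness, so `t ↦ y ⌊t⌋₊ t` glues them. Near `t`
  -- the index `⌊t⌋₊ + 1` is used, so that `t` stays away from the right endpoint.
  have hcoh : ∀ i j : ℕ, i ≤ j → Set.EqOn (y i) (y j) (Set.Icc (0 : ℝ) (i + 1)) := by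
    intro i j hij
    have hij' : (i : ℝ) + 1 ≤ j + 1 := by gcongr
    have hsub : Set.Icc (0 : ℝ) (i + 1) ⊆ Set.Icc 0 (j + 1) := Set.Icc_subset_Icc_right hij'
    have hright : ∀ {l : ℕ} {t : ℝ}, t ∈ Set.Ico (0 : ℝ) (l + 1) →
        HasDerivWithinAt (y l) (F (y l t)) (Set.Ici t) t := by
      intro l t ht
      exact (hy l t (Set.Ico_subset_Icc_self ht)).mono_of_mem_nhdsWithin
        (mem_of_superset (Icc_mem_nhdsGE ht.2) (Set.Icc_subset_Icc_left ht.1))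
    exact ODE_solution_unique (v := fun _ => F) (fun _ => hF)
      (fun t ht => (hy i t ht).continuousWithinAt) (fun t ht => hright ht)
      (fun t ht => (hy j t (hsub ht)).continuousWithinAt.mono hsub)
      (fun t ht => hright ⟨ht.1, ht.2.trans_le hij'⟩) (by rw [hy0, hy0])
  refine ⟨fun t => y ⌊t⌋₊ t, by simp [hy0], fun t ht => ?_⟩
  have heq : ∀ (j : ℕ) (s : ℝ), 0 ≤ s → s < j + 1 → y ⌊s⌋₊ s = y j s := fun j s hs0 hs => by
    refine hcoh _ _ ?_ ⟨hs0, (Nat.lt_floor_add_one s).le⟩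
    have : ⌊s⌋₊ < j + 1 := (Nat.floor_lt hs0).2 (by push_cast; exact hs)
    omega
  obtain ⟨j, hj⟩ : ∃ j, j = ⌊t⌋₊ + 1 := ⟨_, rfl⟩
  have htj : t < (j : ℝ) := by rw [hj]; push_cast; exact Nat.lt_floor_add_one t
  have hmem : Set.Iio ((j : ℝ) + 1) ∈ 𝓝 t := Iio_mem_nhds (by linarith)
  have hmem' : Set.Icc (0 : ℝ) (j + 1) ∈ 𝓝[Set.Ici 0] t :=
    mem_of_superset (inter_mem self_mem_nhdsWithin (mem_nhdsWithin_of_mem_nhds hmem))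
      fun s hs => ⟨hs.1, le_of_lt hs.2⟩
  have h1 : HasDerivWithinAt (y j) (F (y j t)) (Set.Ici 0) t :=
    (hy j t ⟨ht, by linarith⟩).mono_of_mem_nhdsWithin hmem'
  have h2 : y ⌊t⌋₊ t = y j t := heq j t ht (by linarith)
  have h3 : (fun t => y ⌊t⌋₊ t) =ᶠ[𝓝[Set.Ici 0] t] y j := by
    filter_upwards [self_mem_nhdsWithin, mem_nhdsWithin_of_mem_nhds hmem] with s hs0 hs
    exact heq j s hs0 hs
  rw [← h2] at h1
  exact h1.congr_of_eventuallyEq h3 h2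

theorem norm_le_sqrt_dotProduct_self {ι : Type*} [Fintype ι] (v : ι → ℝ) : ‖v‖ ≤ √(v ⬝ᵥ v) := by
  rw [pi_norm_le_iff_of_nonneg (Real.sqrt_nonneg _)]
  intro i
  rw [Real.norm_eq_abs]
  apply Real.abs_le_sqrt
  rw [sq]
  exact Finset.single_le_sum (f := fun j => v j * v j) (fun j _ => mul_self_nonneg _)
    (Finset.mem_univ i)

theorem exists_norm_mulVec_le {ι κ : Type*} [Fintype ι] [Fintype κ] (A : Matrix κ ι ℝ) :
    ∃ M : ℝ, 0 ≤ M ∧ ∀ v, ‖A *ᵥ v‖ ≤ M * √(v ⬝ᵥ v) := by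
  refine ⟨‖LinearMap.toContinuousLinearMap A.mulVecLin‖, norm_nonneg _, fun v => ?_⟩
  exact ((LinearMap.toContinuousLinearMap A.mulVecLin).le_opNorm v).trans
    (mul_le_mul_of_nonneg_left (norm_le_sqrt_dotProduct_self v) (norm_nonneg _))

theorem tendsto_zero_of_dotProduct_self {ι α : Type*} [Fintype ι] {l : Filter α} {v : α → ι → ℝ}
    {g : α → ℝ} (hle : ∀ᶠ a in l, v a ⬝ᵥ v a ≤ g a) (hg : Tendsto g l (𝓝 0)) :
    Tendsto v l (𝓝 0) := by
  have h1 : Tendsto (fun a => √(g a)) l (𝓝 0) := by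
    simpa using hg.sqrt
  refine squeeze_zero_norm' (hle.mono fun a ha => ?_) h1
  exact (norm_le_sqrt_dotProduct_self _).trans (Real.sqrt_le_sqrt ha)

/-! ### Convergence, global existence and the collapse alternative -/

namespace ShapeSystem

variable {n m k : Type*} [Fintype n] [Fintype m] [Fintype k] [DecidableEq k] [DecidableEq m]
  (S : ShapeSystem n m k) {f : ℝ → ℝ} {ρ θ : ℝ}

/-- The vector field as a function of the shape coordinates and the leading side. -/
def reduced (f : ℝ → ℝ) (ρ : ℝ) (e : (m → ℝ) × (k → ℝ)) : n → ℝ :=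
  -((S.L * S.Vᵀ) *ᵥ e.1) + f (e.2 ⬝ᵥ e.2 - ρ) • (S.B *ᵥ e.2)

/-- The shape coordinates and the leading side as a linear map. -/
noncomputable def shape : (n → ℝ) →L[ℝ] (m → ℝ) × (k → ℝ) :=
  (LinearMap.toContinuousLinearMap S.coord.mulVecLin).prod
    (LinearMap.toContinuousLinearMap S.G.mulVecLin)

theorem shape_apply (x : n → ℝ) : S.shape x = (S.coord *ᵥ x, S.G *ᵥ x) := rfl

/-- Motion along the null space, which the energy does not bound, is invisible to the field. Bounds
on the shape therefore suffice to control the velocity. -/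
theorem field_eq_reduced (f : ℝ → ℝ) (ρ : ℝ) (x : n → ℝ) :
    S.field f ρ x = S.reduced f ρ (S.shape x) := by
  rw [field, S.L_mulVec, reduced, shape_apply, mulVec_mulVec]
  rfl

omit [DecidableEq m] in
theorem contDiff_reduced (hf : ContDiff ℝ 1 f) (ρ : ℝ) : ContDiff ℝ 1 (S.reduced f ρ) := by
  have h1 : ContDiff ℝ 1 fun e : (m → ℝ) × (k → ℝ) => (S.L * S.Vᵀ) *ᵥ e.1 :=
    (LinearMap.toContinuousLinearMap (S.L * S.Vᵀ).mulVecLin).contDiff.comp contDiff_fst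
  have h2 : ContDiff ℝ 1 fun e : (m → ℝ) × (k → ℝ) => S.B *ᵥ e.2 :=
    (LinearMap.toContinuousLinearMap S.B.mulVecLin).contDiff.comp contDiff_snd
  have h3 : ContDiff ℝ 1 fun e : (m → ℝ) × (k → ℝ) => e.2 ⬝ᵥ e.2 - ρ := by
    unfold dotProduct
    fun_prop
  exact h1.neg.add ((hf.comp h3).smul h2)

/-- A forward solution of the closed loop. -/
def IsForwardSolution (f : ℝ → ℝ) (ρ : ℝ) (x : ℝ → n → ℝ) : Prop :=
  ∀ t, 0 ≤ t → HasDerivWithinAt x (S.field f ρ (x t)) (Set.Ici 0) t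

/-- Exponential convergence with rate `r` to a rest state of the desired size. -/
def ConvergesToSized (ρ r : ℝ) (x : ℝ → n → ℝ) : Prop :=
  ∃ z, S.V *ᵥ z = 0 ∧ S.sqSide z = ρ ∧ ∃ C : ℝ, ∀ t, 0 ≤ t → ‖x t - z‖ ≤ C * Real.exp (-(r * t))

theorem IsForwardSolution.energy_deriv {S : ShapeSystem n m k} {x : ℝ → n → ℝ}
    (hx : S.IsForwardSolution f ρ x) (hf : ContDiff ℝ 1 f) (θ : ℝ) (t : ℝ) (ht : 0 ≤ t) :
    HasDerivWithinAt (fun τ => S.energy f ρ θ (x τ))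
      (2 * S.dissip θ (deriv f (S.sqSide (x t) - ρ)) (S.coord *ᵥ x t)
        (S.gain f ρ (x t) • (S.G *ᵥ x t))) (Set.Ici 0) t :=
  (S.hasDerivWithinAt_energy hf ρ θ (hx t ht)).congr_deriv (S.energy_deriv_field f ρ θ (x t))

theorem strictMonoOn_gain (hf : ContDiff ℝ 1 f) (hf' : ∀ p : ℝ, -ρ ≤ p → 0 < deriv f p) :
    StrictMonoOn f (Set.Ici (-ρ)) :=
  strictMonoOn_of_deriv_pos (convex_Ici _) hf.continuous.continuousOn
    fun p hp => hf' p (interior_subset hp)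

/-- Exponential decay of the Lyapunov function yields exponential convergence. -/
theorem IsForwardSolution.convergesToSized {S : ShapeSystem n m k} {x : ℝ → n → ℝ}
    (hx : S.IsForwardSolution f ρ x) (hf : ContDiff ℝ 1 f) (hf0 : f 0 = 0) (hρ : 0 < ρ)
    (hf' : ∀ p : ℝ, -ρ ≤ p → 0 < deriv f p) (hθ : 0 < θ) {r C : ℝ} (hr : 0 < r)
    (hE : ∀ t, 0 ≤ t → S.energy f ρ θ (x t) ≤ C * Real.exp (-(r * t))) :
    S.ConvergesToSized ρ (r / 2) x := by
  have hmono := strictMonoOn_gain hf hf'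
  have hf1 : 0 < f 1 := by
    rw [← hf0]
    exact hmono (by simp [hρ.le]) (Set.mem_Ici.2 (by linarith)) one_pos
  have hC : 0 ≤ C := by simpa using (S.energy_nonneg f ρ θ _).trans (hE 0 le_rfl)
  have hexp : Tendsto (fun t : ℝ => C * Real.exp (-(r * t))) atTop (𝓝 0) := by
    have h1 : Tendsto (fun t : ℝ => r * t) atTop atTop := tendsto_id.const_mul_atTop hr
    simpa using (Real.tendsto_exp_neg_atTop_nhds_zero.comp h1).const_mul C
  have hElim : Tendsto (fun t => S.energy f ρ θ (x t)) atTop (𝓝 0) :=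
    squeeze_zero' (Eventually.of_forall fun t => S.energy_nonneg f ρ θ _)
      ((eventually_ge_atTop 0).mono hE) hexp
  -- Linear growth of `f` is not available here. Strict monotonicity bounds the squared side by `1 +
  -- ρ` once the energy is below `θ² f(1)²`, and compactness covers the time before.
  have hside : ∃ Q, 0 ≤ Q ∧ ∀ t, 0 ≤ t → S.sqSide (x t) ≤ Q := by
    obtain ⟨T, hT⟩ := ((hElim.eventually (gt_mem_nhds
      (show 0 < θ ^ 2 * f 1 ^ 2 by positivity))).and
      (eventually_ge_atTop 0)).exists_forall_of_atTop
    have hcont : ContinuousOn (fun t => S.sqSide (x t)) (Set.Icc 0 T) := by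
      have hxc : ContinuousOn x (Set.Icc 0 T) := fun t ht =>
        (hx t ht.1).continuousWithinAt.mono Set.Icc_subset_Ici_self
      have : Continuous S.sqSide := by unfold sqSide; fun_prop
      exact this.comp_continuousOn hxc
    obtain ⟨M, hM⟩ := isCompact_Icc.bddAbove_image hcont
    refine ⟨max (max M (1 + ρ)) 0, le_max_right _ _, fun t ht => le_max_of_le_left ?_⟩
    rcases le_total t T with h | h
    · exact le_max_of_le_left (hM ⟨t, ⟨ht, h⟩, rfl⟩)
    · refine le_max_of_le_right ?_
      by_contra! hlt
      have h1 := hmono (a := 1) (b := S.sqSide (x t) - ρ) (Set.mem_Ici.2 (by linarith))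
        (Set.mem_Ici.2 (by linarith)) (by linarith)
      have h2 := S.gain_sq_le_energy f ρ θ (x t)
      have h3 := (hT t h).1
      have h4 : f 1 ^ 2 < S.gain f ρ (x t) ^ 2 := by
        unfold gain
        nlinarith
      have h5 : θ ^ 2 * f 1 ^ 2 < θ ^ 2 * S.gain f ρ (x t) ^ 2 := by gcongr
      linarith
  obtain ⟨Q, hQ, hside⟩ := hside
  obtain ⟨c, hc, hgram⟩ := S.exists_gram_lower_bound
  obtain ⟨M₁, hM₁, hL⟩ := exists_norm_mulVec_le (S.L * S.Vᵀ)
  obtain ⟨M₂, hM₂, hB⟩ := exists_norm_mulVec_le S.B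
  have hcoord : ∀ y, (S.coord *ᵥ y) ⬝ᵥ (S.coord *ᵥ y) ≤ S.energy f ρ θ y / c := fun y => by
    rw [le_div_iff₀ hc, mul_comm]
    exact (hgram _).trans (le_add_of_nonneg_right (by positivity))
  have hgain : ∀ y, |S.gain f ρ y| ≤ √(S.energy f ρ θ y) / θ := fun y => by
    rw [le_div_iff₀ hθ]
    apply Real.le_sqrt_of_sq_le
    rw [mul_pow, sq_abs, mul_comm]
    exact S.gain_sq_le_energy f ρ θ y
  -- The speed is bounded by a constant times the square root of the energy, whence the rate `r /
  -- 2`.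
  have hbound : ∀ t, 0 ≤ t → ‖S.field f ρ (x t)‖
      ≤ ((M₁ / √c + M₂ * √Q / θ) * √C) * Real.exp (-(r / 2 * t)) := by
    intro t ht
    have hsq : √(S.energy f ρ θ (x t)) ≤ √C * Real.exp (-(r / 2 * t)) := by
      refine (Real.sqrt_le_sqrt (hE t ht)).trans_eq ?_
      rw [Real.sqrt_mul hC]
      congr 1
      rw [Real.sqrt_eq_iff_mul_self_eq (Real.exp_pos _).le (Real.exp_pos _).le, ← Real.exp_add]
      congr 1
      ring
    have h1 : ‖(S.L * S.Vᵀ) *ᵥ (S.coord *ᵥ x t)‖ ≤ M₁ / √c * √(S.energy f ρ θ (x t)) := by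
      refine (hL _).trans ?_
      rw [div_mul_eq_mul_div, mul_div_assoc, ← Real.sqrt_div' _ hc.le]
      exact mul_le_mul_of_nonneg_left (Real.sqrt_le_sqrt (hcoord _)) hM₁
    have h2 : ‖S.gain f ρ (x t) • (S.B *ᵥ (S.G *ᵥ x t))‖
        ≤ M₂ * √Q / θ * √(S.energy f ρ θ (x t)) := by
      rw [norm_smul, Real.norm_eq_abs]
      have h3 : ‖S.B *ᵥ (S.G *ᵥ x t)‖ ≤ M₂ * √Q :=
        (hB _).trans (mul_le_mul_of_nonneg_left (Real.sqrt_le_sqrt (hside t ht)) hM₂)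
      calc _ ≤ √(S.energy f ρ θ (x t)) / θ * (M₂ * √Q) :=
            mul_le_mul (hgain _) h3 (norm_nonneg _) (by positivity)
        _ = _ := by ring
    have h4 : ‖S.field f ρ (x t)‖ ≤ (M₁ / √c + M₂ * √Q / θ) * √(S.energy f ρ θ (x t)) := by
      rw [field, S.L_mulVec, mulVec_mulVec, add_mul]
      refine (norm_add_le _ _).trans (add_le_add ?_ h2)
      rw [norm_neg]
      exact h1
    refine h4.trans ?_
    rw [mul_assoc]
    exact mul_le_mul_of_nonneg_left hsq (by positivity)
  obtain ⟨z, hz⟩ := exists_limit_of_deriv_le_exp (half_pos hr) hx hbound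
  have hlim : Tendsto x atTop (𝓝 z) := by
    rw [tendsto_iff_norm_sub_tendsto_zero]
    have h1 : Tendsto (fun t : ℝ => r / 2 * t) atTop atTop :=
      tendsto_id.const_mul_atTop (half_pos hr)
    refine squeeze_zero' (Eventually.of_forall fun t => norm_nonneg _)
      ((eventually_ge_atTop 0).mono hz) ?_
    simpa using (Real.tendsto_exp_neg_atTop_nhds_zero.comp h1).const_mul
      ((M₁ / √c + M₂ * √Q / θ) * √C / (r / 2))
  have hEcont : Continuous (S.energy f ρ θ) := by
    have := hf.continuous
    unfold energy gain sqSide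
    fun_prop
  have hEz : S.energy f ρ θ z = 0 :=
    tendsto_nhds_unique ((hEcont.tendsto z).comp hlim) hElim
  refine ⟨z, ?_, ?_, _, hz⟩
  · have h1 := hcoord z
    rw [hEz, zero_div] at h1
    have h2 := dotProduct_self_eq_zero.1 (le_antisymm h1 (dotProduct_self_nonneg' _))
    rw [← gram_mulVec_coord, h2, mulVec_zero]
  -- Zero energy gives `f (sqSide - ρ) = f 0`, and injectivity of `f` on `[-ρ, ∞)` yields the
  -- desired size.
  · have h1 := hgain z
    rw [hEz, Real.sqrt_zero, zero_div] at h1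
    have h2 : f (S.sqSide z - ρ) = f 0 := by
      rw [hf0]; exact abs_nonpos_iff.1 h1
    have h3 := hmono.injOn (Set.mem_Ici.2 (by linarith [S.sqSide_nonneg z]))
      (Set.mem_Ici.2 (by linarith)) h2
    linarith

/-- Uniform negativity along a solution implies exponential convergence. -/
theorem exists_rate_of_uniform_dissip (S : ShapeSystem n m k) (hf : ContDiff ℝ 1 f)
    (hf0 : f 0 = 0) (hρ : 0 < ρ) (hf' : ∀ p : ℝ, -ρ ≤ p → 0 < deriv f p) (hθ : 0 < θ)
    {c : ℝ} (hc : 0 < c) :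
    ∃ r : ℝ, 0 < r ∧ ∀ x, S.IsForwardSolution f ρ x →
      (∀ t, 0 ≤ t → S.dissip θ (deriv f (S.sqSide (x t) - ρ)) (S.coord *ᵥ x t)
          (S.gain f ρ (x t) • (S.G *ᵥ x t))
        ≤ -c * ((S.coord *ᵥ x t) ⬝ᵥ (S.coord *ᵥ x t) + (θ * S.gain f ρ (x t)) ^ 2)) →
      S.ConvergesToSized ρ r x := by
  obtain ⟨r, hr, h⟩ := S.exists_rate_of_dissip_le hc f ρ θ
  refine ⟨r / 2, half_pos hr, fun x hx hd => ?_⟩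
  refine hx.convergesToSized hf hf0 hρ hf' hθ hr (C := S.energy f ρ θ (x 0)) fun t ht => ?_
  have := le_mul_exp_of_deriv_le le_rfl (hx.energy_deriv hf θ)
    (fun t ht => h _ _ _ (hd t ht)) ht
  simpa using this

section SchurRegime

variable (hf : ContDiff ℝ 1 f) (hf0 : f 0 = 0) (hρ : 0 < ρ)
    (hf' : ∀ p : ℝ, -ρ ≤ p → 0 < deriv f p) (hθ : 0 < θ)
    (hneg : ∀ p : ℝ, -ρ ≤ p → ∀ (z : m → ℝ) (v : k → ℝ), (z, v) ≠ 0 →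
      S.dissip θ (deriv f p) z v < 0)

include hneg in
omit [DecidableEq m] in
theorem dissip_nonpos {p : ℝ} (hp : -ρ ≤ p) (z : m → ℝ) (v : k → ℝ) :
    S.dissip θ (deriv f p) z v ≤ 0 := by
  by_cases h : (z, v) = 0
  · obtain ⟨rfl, rfl⟩ := Prod.ext_iff.1 h
    simp [dissip]
  · exact (hneg p hp z v h).le

include hf hf0 hρ hf' hθ hneg in
/-- Sublevel sets of the Lyapunov function are bounded in the shape variables. -/
theorem exists_norm_shape_le (η : ℝ) :
    ∃ R : ℝ, 0 < R ∧ ∀ x, S.energy f ρ θ x ≤ η → ‖S.shape x‖ ≤ R := by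
  obtain ⟨Q, hQ, hside⟩ := S.exists_sqSide_bound hf hf0 hρ hf' hθ hneg η
  obtain ⟨c, hc, hgram⟩ := S.exists_gram_lower_bound
  refine ⟨max √(η / c) √Q, lt_max_of_lt_right (Real.sqrt_pos.2 hQ), fun x hx => ?_⟩
  rw [shape_apply, Prod.norm_mk]
  refine max_le_max ?_ ?_
  · refine (norm_le_sqrt_dotProduct_self _).trans (Real.sqrt_le_sqrt ?_)
    rw [le_div_iff₀ hc, mul_comm]
    exact ((hgram _).trans (le_add_of_nonneg_right (by positivity))).trans hx
  · exact (norm_le_sqrt_dotProduct_self _).trans (Real.sqrt_le_sqrt (hside x hx))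

include hf hf0 hρ hf' hθ hneg in
/-- Global existence of forward solutions. -/
theorem exists_isForwardSolution (x₀ : n → ℝ) :
    ∃ x, S.IsForwardSolution f ρ x ∧ x 0 = x₀ := by
  obtain ⟨R, hR, hbound⟩ := S.exists_norm_shape_le hf hf0 hρ hf' hθ hneg (S.energy f ρ θ x₀)
  -- The cut-off makes the field bounded and Lipschitz. It only multiplies the velocity by `χ ≥ 0`,
  -- so the energy still does not increase and the shape never leaves the ball of radius `R`, where
  -- `χ = 1`.
  let χ : ContDiffBump (0 : (m → ℝ) × (k → ℝ)) := ⟨R, R + 1, hR, by linarith⟩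
  let H : (m → ℝ) × (k → ℝ) → n → ℝ := fun e => χ e • S.reduced f ρ e
  have hH : ContDiff ℝ 1 H := χ.contDiff.smul (S.contDiff_reduced hf ρ)
  have hsupp : HasCompactSupport H := χ.hasCompactSupport.smul_right
  obtain ⟨K, hK⟩ := hH.lipschitzWith_of_hasCompactSupport hsupp one_ne_zero
  obtain ⟨M, hM⟩ := hsupp.exists_bound_of_continuous hH.continuous
  have hM0 : 0 ≤ M := (norm_nonneg _).trans (hM 0)
  obtain ⟨x, hx0, hx⟩ := exists_forward_solution (F := fun y => H (S.shape y))
    (hK.comp S.shape.lipschitz) (M := ⟨M, hM0⟩) (fun y => hM _) x₀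
  have hanti : AntitoneOn (fun t => S.energy f ρ θ (x t)) (Set.Ici 0) := by
    refine antitoneOn_Ici_of_hasDerivWithinAt le_rfl
      (fun t ht => S.hasDerivWithinAt_energy hf ρ θ (hx t ht)) fun t ht => ?_
    have hv : H (S.shape (x t)) = χ (S.shape (x t)) • S.field f ρ (x t) := by
      rw [field_eq_reduced]
    have h1 := S.energy_deriv_field f ρ θ (x t)
    have h2 := S.dissip_nonpos hneg (p := S.sqSide (x t) - ρ)
      (by linarith [S.sqSide_nonneg (x t)]) (S.coord *ᵥ x t) (S.gain f ρ (x t) • (S.G *ᵥ x t))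
    have h3 : 0 ≤ χ (S.shape (x t)) := χ.nonneg
    rw [hv, mulVec_smul, mulVec_smul, dotProduct_smul, dotProduct_smul, smul_eq_mul, smul_eq_mul]
    calc _ = χ (S.shape (x t)) * (2 * ((S.coord *ᵥ x t) ⬝ᵥ (S.V *ᵥ S.field f ρ (x t)))
        + 2 * θ ^ 2 * S.gain f ρ (x t) * (deriv f (S.sqSide (x t) - ρ)
          * (2 * ((S.G *ᵥ x t) ⬝ᵥ (S.G *ᵥ S.field f ρ (x t)))))) := by ring
      _ ≤ 0 := by
        rw [h1]
        exact mul_nonpos_of_nonneg_of_nonpos h3 (by linarith)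
  refine ⟨x, fun t ht => (hx t ht).congr_deriv ?_, hx0⟩
  have h1 : ‖S.shape (x t)‖ ≤ R := by
    apply hbound
    rw [← hx0]
    exact hanti Set.self_mem_Ici ht ht
  have h2 : χ (S.shape (x t)) = 1 :=
    χ.one_of_mem_closedBall (by simpa using h1)
  simp only [H, h2, one_smul, field_eq_reduced]

include hf hf0 hρ hf' hθ hneg in
/-- If the Lyapunov function never falls below its value at the collapsed states, then the
solution collapses. -/
theorem tendsto_shape_of_energy_ge {x : ℝ → n → ℝ} (hx : S.IsForwardSolution f ρ x)
    (hge : ∀ t, 0 ≤ t → θ ^ 2 * f (-ρ) ^ 2 ≤ S.energy f ρ θ (x t)) :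
    Tendsto (fun t => S.shape (x t)) atTop (𝓝 0) := by
  have hmono := strictMonoOn_gain hf hf'
  have hfρ : f (-ρ) < 0 := by
    rw [← hf0]
    exact hmono Set.self_mem_Ici (Set.mem_Ici.2 (by linarith)) (by linarith)
  have hη₀ : 0 < θ ^ 2 * f (-ρ) ^ 2 := by
    have := hfρ.ne
    positivity
  have hder := hx.energy_deriv hf θ
  have hanti : AntitoneOn (fun t => S.energy f ρ θ (x t)) (Set.Ici 0) :=
    antitoneOn_Ici_of_hasDerivWithinAt le_rfl hder fun t ht =>
      mul_nonpos_of_nonneg_of_nonpos zero_le_two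
        (S.dissip_nonpos hneg (by linarith [S.sqSide_nonneg (x t)]) _ _)
  have hle : ∀ t, 0 ≤ t → S.energy f ρ θ (x t) ≤ S.energy f ρ θ (x 0) := fun t ht =>
    hanti Set.self_mem_Ici ht ht
  obtain ⟨c, hc, hdis⟩ :=
    S.exists_dissip_bound_of_ge hf hf0 hρ hf' hθ hneg hη₀ (S.energy f ρ θ (x 0))
  obtain ⟨R, hR, hbound⟩ := S.exists_norm_shape_le hf hf0 hρ hf' hθ hneg (S.energy f ρ θ (x 0))
  have hred := (S.contDiff_reduced hf ρ).continuous
  have hcomp : IsCompact (Metric.closedBall (0 : (m → ℝ) × (k → ℝ)) R) := isCompact_closedBall 0 R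
  -- The bounded function is the derivative of `|z|² + |u|²` along the flow as a function of the
  -- shape; `K` is the Lipschitz constant for the Barbalat step.
  obtain ⟨K, hK⟩ := hcomp.exists_bound_of_continuousOn
    (f := fun e => 2 * (e.1 ⬝ᵥ (S.coord *ᵥ S.reduced f ρ e))
      + 2 * (e.2 ⬝ᵥ (S.G *ᵥ S.reduced f ρ e))) (by fun_prop)
  have hK0 : 0 ≤ K := (norm_nonneg _).trans (hK 0 (by simp [hR.le]))
  let g : ℝ → ℝ := fun t => (S.coord *ᵥ x t) ⬝ᵥ (S.coord *ᵥ x t) + S.sqSide (x t)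
  have hgder : ∀ t, 0 ≤ t → HasDerivWithinAt g
      (2 * ((S.coord *ᵥ x t) ⬝ᵥ (S.coord *ᵥ S.field f ρ (x t)))
        + 2 * ((S.G *ᵥ x t) ⬝ᵥ (S.G *ᵥ S.field f ρ (x t)))) (Set.Ici 0) t := fun t ht => by
    have hz := (hx t ht).mulVec_const S.coord
    have hu := (hx t ht).mulVec_const S.G
    refine HasDerivWithinAt.congr_deriv (f := g) ((hz.dotProduct hz).add (hu.dotProduct hu)) ?_
    rw [dotProduct_comm (S.coord *ᵥ S.field f ρ (x t)), dotProduct_comm (S.G *ᵥ S.field f ρ (x t))]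
    ring
  have hg : Tendsto g atTop (𝓝 0) := by
    refine tendsto_zero_of_dissipation hc hK0 hder (fun t _ => S.energy_nonneg f ρ θ _)
      (fun t _ => add_nonneg (dotProduct_self_nonneg' _) (S.sqSide_nonneg _))
      (fun t ht => hdis _ (hge t ht) (hle t ht)) fun s t hs hst => ?_
    have h1 := (convex_Ici (0 : ℝ)).norm_image_sub_le_of_norm_hasDerivWithin_le (f := g) (C := K)
      hgder (fun τ hτ => by
        rw [field_eq_reduced]
        exact hK (S.shape (x τ)) (by simpa using hbound _ (hle τ hτ))) hs (hs.trans hst)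
    rw [Real.norm_eq_abs, Real.norm_eq_abs, abs_of_nonneg (sub_nonneg.2 hst)] at h1
    linarith [neg_le_of_abs_le h1]
  have h1 : Tendsto (fun t => S.coord *ᵥ x t) atTop (𝓝 0) :=
    tendsto_zero_of_dotProduct_self (Eventually.of_forall fun t =>
      le_add_of_nonneg_right (S.sqSide_nonneg _)) hg
  have h2 : Tendsto (fun t => S.G *ᵥ x t) atTop (𝓝 0) :=
    tendsto_zero_of_dotProduct_self (Eventually.of_forall fun t =>
      le_add_of_nonneg_left (dotProduct_self_nonneg' _)) hg
  exact h1.prodMk_nhds h2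

include hf hf0 hρ hf' hθ hneg in
/-- Every solution converges exponentially, with a common rate, or collapses. -/
theorem exists_rate_convergesToSized_or_collapse :
    ∃ r : ℝ, 0 < r ∧ ∀ x, S.IsForwardSolution f ρ x →
      S.ConvergesToSized ρ r x ∨ Tendsto (fun t => S.shape (x t)) atTop (𝓝 0) := by
  have hmono := strictMonoOn_gain hf hf'
  have hfρ : f (-ρ) < 0 := by
    rw [← hf0]
    exact hmono Set.self_mem_Ici (Set.mem_Ici.2 (by linarith)) (by linarith)
  have hη₀ : 0 < θ ^ 2 * f (-ρ) ^ 2 := by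
    have := hfρ.ne
    positivity
  -- The rate is fixed at half the collapse level, which makes it common to all solutions. The
  -- solution-dependent rate `r₁` below serves only to reach that level in finite time.
  obtain ⟨r, hr, hrate⟩ := S.exists_rate_of_lt hf hf0 hρ hf' hθ hneg (half_lt_self hη₀)
  refine ⟨r / 2, half_pos hr, fun x hx => ?_⟩
  by_cases hge : ∀ t, 0 ≤ t → θ ^ 2 * f (-ρ) ^ 2 ≤ S.energy f ρ θ (x t)
  · exact Or.inr (S.tendsto_shape_of_energy_ge hf hf0 hρ hf' hθ hneg hx hge)
  · left
    push Not at hge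
    obtain ⟨t₀, ht₀, hlt⟩ := hge
    have hder := hx.energy_deriv hf θ
    have hanti : AntitoneOn (fun t => S.energy f ρ θ (x t)) (Set.Ici 0) :=
      antitoneOn_Ici_of_hasDerivWithinAt le_rfl hder fun t ht =>
        mul_nonpos_of_nonneg_of_nonpos zero_le_two
          (S.dissip_nonpos hneg (by linarith [S.sqSide_nonneg (x t)]) _ _)
    obtain ⟨r₁, hr₁, hrate₁⟩ := S.exists_rate_of_lt hf hf0 hρ hf' hθ hneg hlt
    have hdec₁ : ∀ t, t₀ ≤ t → S.energy f ρ θ (x t)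
        ≤ S.energy f ρ θ (x t₀) * Real.exp (-(r₁ * (t - t₀))) := fun t ht =>
      le_mul_exp_of_deriv_le ht₀ hder
        (fun s hs => hrate₁ _ (hanti ht₀ (Set.mem_Ici.2 (ht₀.trans hs)) hs)) ht
    have hlim : Tendsto (fun t : ℝ => S.energy f ρ θ (x t₀) * Real.exp (-(r₁ * (t - t₀)))) atTop
        (𝓝 0) := by
      have h1 : Tendsto (fun t : ℝ => r₁ * (t - t₀)) atTop atTop :=
        (tendsto_atTop_add_const_right atTop (-t₀) tendsto_id).const_mul_atTop hr₁
      simpa using (Real.tendsto_exp_neg_atTop_nhds_zero.comp h1).const_mul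
        (S.energy f ρ θ (x t₀))
    obtain ⟨t₁, hlt₁, ht₁⟩ := ((hlim.eventually (gt_mem_nhds (half_pos hη₀))).and
      (eventually_ge_atTop t₀)).exists
    have ht₁0 : 0 ≤ t₁ := ht₀.trans ht₁
    have hE₁ : S.energy f ρ θ (x t₁) ≤ θ ^ 2 * f (-ρ) ^ 2 / 2 := (hdec₁ t₁ ht₁).trans hlt₁.le
    have hdec : ∀ t, t₁ ≤ t → S.energy f ρ θ (x t)
        ≤ S.energy f ρ θ (x t₁) * Real.exp (-(r * (t - t₁))) := fun t ht =>
      le_mul_exp_of_deriv_le ht₁0 hder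
        (fun s hs => hrate _ ((hanti ht₁0 (Set.mem_Ici.2 (ht₁0.trans hs)) hs).trans hE₁)) ht
    refine hx.convergesToSized hf hf0 hρ hf' hθ hr
      -- The factor `exp (r t₁)` pays for the time before the common rate sets in.
      (C := S.energy f ρ θ (x 0) * Real.exp (r * t₁)) fun t ht => ?_
    have he : Real.exp (r * t₁) * Real.exp (-(r * t)) = Real.exp (-(r * (t - t₁))) := by
      rw [← Real.exp_add]; congr 1; ring
    rw [mul_assoc, he]
    rcases le_total t₁ t with h | h
    · refine (hdec t h).trans ?_
      gcongr
      exact hanti Set.self_mem_Ici ht₁0 ht₁0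
    · have h1 : S.energy f ρ θ (x t) ≤ S.energy f ρ θ (x 0) := hanti Set.self_mem_Ici ht ht
      refine h1.trans (le_mul_of_one_le_right (S.energy_nonneg _ _ _ _) ?_)
      exact Real.one_le_exp (by nlinarith)

end SchurRegime

end ShapeSystem

/-! ### Rotations about the axis -/

section Rotations

variable {d : ℕ}

theorem rot_zero (hd : d = 2 ∨ d = 3) : rot d 0 = 1 := by
  rcases hd with rfl | rfl <;> ext i j <;> fin_cases i <;> fin_cases j <;> simp [rot]

theorem rot_transpose (hd : d = 2 ∨ d = 3) (α : ℝ) : (rot d α)ᵀ = rot d (-α) := by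
  rcases hd with rfl | rfl <;> ext i j <;> fin_cases i <;> fin_cases j <;> simp [rot]

theorem rot_mul_rot (hd : d = 2 ∨ d = 3) (α β : ℝ) : rot d α * rot d β = rot d (α + β) := by
  rcases hd with rfl | rfl <;> ext i j <;> fin_cases i <;> fin_cases j <;>
    simp [rot, Matrix.mul_apply, Fin.sum_univ_succ, Real.cos_add, Real.sin_add] <;> ring

theorem rot_two_pi (hd : d = 2 ∨ d = 3) : rot d (2 * Real.pi) = 1 := by
  rw [← rot_zero hd]
  simp [rot]

theorem rot_transpose_mul (hd : d = 2 ∨ d = 3) (α : ℝ) : (rot d α)ᵀ * rot d α = 1 := by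
  rw [rot_transpose hd, rot_mul_rot hd, neg_add_cancel, rot_zero hd]

theorem rot_mulVec_dotProduct_self (hd : d = 2 ∨ d = 3) (α : ℝ) (v : Fin d → ℝ) :
    (rot d α *ᵥ v) ⬝ᵥ (rot d α *ᵥ v) = v ⬝ᵥ v := by
  rw [dotProduct_mulVec, ← mulVec_transpose, mulVec_mulVec, rot_transpose_mul hd, one_mulVec]

theorem rot_mulVec_injective (hd : d = 2 ∨ d = 3) (α : ℝ) {v w : Fin d → ℝ}
    (h : rot d α *ᵥ v = rot d α *ᵥ w) : v = w := by
  have := congrArg ((rot d α)ᵀ *ᵥ ·) h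
  simpa [mulVec_mulVec, rot_transpose_mul hd] using this

/-- The matrix of the rotation minus the identity has determinant `2 (1 - c)`; the linear
combinations apply its adjugate, up to a factor. -/
theorem eq_zero_of_planar_rotation {c s x y : ℝ} (hc : c < 1) (hsc : s ^ 2 + c ^ 2 = 1)
    (hx : c * x - s * y = x) (hy : s * x + c * y = y) : x = 0 ∧ y = 0 := by
  have hne : 1 - c ≠ 0 := by linarith
  refine ⟨mul_right_cancel₀ hne ?_, mul_right_cancel₀ hne ?_⟩
  · linear_combination (-x / 2) * hsc - (1 - c) / 2 * hx + s / 2 * hy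
  · linear_combination (-y / 2) * hsc - (1 - c) / 2 * hy - s / 2 * hx

/-- A vector fixed by a nontrivial rotation vanishes once its axial part does. -/
theorem eq_zero_of_rot_mulVec_eq_self (hd : d = 2 ∨ d = 3) {α : ℝ} (hα : Real.cos α < 1)
    {v : Fin d → ℝ} (h : rot d α *ᵥ v = v) (hv : ∀ k : Fin d, 2 ≤ (k : ℕ) → v k = 0) : v = 0 := by
  have hsc := Real.sin_sq_add_cos_sq α
  rcases hd with rfl | rfl
  · have h0 := congrFun h 0
    have h1 := congrFun h 1
    simp [rot, mulVec, dotProduct, Fin.sum_univ_succ, ← sub_eq_add_neg] at h0 h1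
    obtain ⟨h2, h3⟩ := eq_zero_of_planar_rotation hα hsc h0 h1
    ext k
    fin_cases k
    exacts [h2, h3]
  · have h0 := congrFun h 0
    have h1 := congrFun h 1
    simp [rot, mulVec, dotProduct, Fin.sum_univ_succ, ← sub_eq_add_neg] at h0 h1
    obtain ⟨h2, h3⟩ := eq_zero_of_planar_rotation hα hsc h0 h1
    ext k
    fin_cases k
    exacts [h2, h3, hv 2 le_rfl]

theorem rot_mulVec_axial (α : ℝ) (v : Fin d → ℝ) {k : Fin d} (hk : 2 ≤ (k : ℕ)) :
    (rot d α *ᵥ v) k = v k := by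
  have h : ∀ l, rot d α k l = if k = l then 1 else 0 := fun l => by
    rw [rot, of_apply, if_neg fun hkl => absurd hkl.1 (Nat.not_lt.2 hk)]
  simp [mulVec, dotProduct, h]

end Rotations

/-! ### Cyclic sums and nonnegative quadratic forms -/

section Cyclic

theorem ZMod.forall_of_add_one {N : ℕ} [NeZero N] {P : ZMod N → Prop} {a : ZMod N} (ha : P a)
    (hs : ∀ i, P i → P (i + 1)) (i : ZMod N) : P i := by
  have h : ∀ j : ℕ, P (a + j) := fun j => by
    induction j with
    | zero => simpa using ha
    | succ j ih => simpa [add_assoc] using hs _ ih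
  simpa using h (i - a).val

theorem ZMod.sum_add_const {N : ℕ} [NeZero N] {M : Type*} [AddCommMonoid M] (F : ZMod N → M)
    (a : ZMod N) : ∑ i, F (i + a) = ∑ i, F i :=
  Equiv.sum_comp (Equiv.addRight a) F

theorem ZMod.sum_eq_sum_range {N : ℕ} [NeZero N] {M : Type*} [AddCommMonoid M]
    (F : ZMod N → M) : ∑ i, F i = ∑ j ∈ Finset.range N, F (j : ZMod N) := by
  symm
  refine Finset.sum_bij (fun j _ => (j : ZMod N)) (fun _ _ => Finset.mem_univ _) ?_ ?_
    (fun _ _ => rfl)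
  · intro a ha b hb hab
    have := congrArg ZMod.val hab
    rwa [ZMod.val_cast_of_lt (Finset.mem_range.1 ha), ZMod.val_cast_of_lt (Finset.mem_range.1 hb)]
      at this
  · exact fun i _ => ⟨i.val, Finset.mem_range.2 i.val_lt, by simp⟩

/-- The quadratic form of a path is bounded below by its boundary values. -/
theorem sin_mul_path_form_ge {N : ℕ} (hN : 2 ≤ N) (y : ℕ → ℝ) {j : ℕ} (hj : j + 2 ≤ N) :
    Real.sin (Real.pi / N) * (Real.cos ((j + 1 : ℕ) * (Real.pi / N)) * (y 0 ^ 2 + y (j + 1) ^ 2) / 2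
        - y 0 * y (j + 1))
      ≤ Real.sin ((j + 1 : ℕ) * (Real.pi / N)) * ∑ i ∈ Finset.range (j + 1),
        (Real.cos (Real.pi / N) / 2 * (y i ^ 2 + y (i + 1) ^ 2) - y i * y (i + 1)) := by
  have hN0 : (0 : ℝ) < N := by positivity
  induction j with
  | zero =>
    simp
    apply le_of_eq
    ring
  | succ j ih =>
    have ih := ih (by omega)
    rw [Finset.sum_range_succ]
    set s := Real.sin (Real.pi / N)
    set c := Real.cos (Real.pi / N)
    set T := ∑ i ∈ Finset.range (j + 1), (c / 2 * (y i ^ 2 + y (i + 1) ^ 2) - y i * y (i + 1))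
    have hang : ((j + 1 + 1 : ℕ) : ℝ) * (Real.pi / N)
        = ((j + 1 : ℕ) : ℝ) * (Real.pi / N) + Real.pi / N := by push_cast; ring
    have hpos : ∀ l : ℕ, 0 < l → l < N → 0 < Real.sin ((l : ℝ) * (Real.pi / N)) := by
      intro l hl hlN
      have hl' : (0 : ℝ) < l := by exact_mod_cast hl
      have hlN' : (l : ℝ) < N := by exact_mod_cast hlN
      apply Real.sin_pos_of_pos_of_lt_pi
      · positivity
      · rw [mul_div_assoc', div_lt_iff₀ hN0, mul_comm]
        exact mul_lt_mul_of_pos_left hlN' Real.pi_pos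
    have hsn := hpos (j + 1) (by omega) (by omega)
    have hsn1 := hpos (j + 1 + 1) (by omega) (by omega)
    rw [hang, Real.sin_add] at hsn1
    rw [hang, Real.sin_add, Real.cos_add]
    set sn := Real.sin (((j + 1 : ℕ) : ℝ) * (Real.pi / N))
    set cn := Real.cos (((j + 1 : ℕ) : ℝ) * (Real.pi / N))
    have hid : sn ^ 2 + cn ^ 2 = 1 := Real.sin_sq_add_cos_sq _
    have hid1 : s ^ 2 + c ^ 2 = 1 := Real.sin_sq_add_cos_sq _
    have h1 := mul_le_mul_of_nonneg_left ih hsn1.le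
    refine le_of_mul_le_mul_left ?_ hsn
    set p := y 0
    set q := y (j + 1)
    set r := y (j + 1 + 1)
    have hsq := sq_nonneg ((sn * c + cn * s) * q - s * p - sn * r)
    -- Adding an edge makes `q` an interior value. Cleared of the positive sines, the difference of
    -- the two sides is a perfect square in `q`, with `sn * c + cn * s = sin ((j + 2) π / N)`.
    have e : (sn * c + cn * s) * (s * (cn * (p ^ 2 + q ^ 2) / 2 - p * q))
        + sn * (sn * c + cn * s) * (c / 2 * (q ^ 2 + r ^ 2) - q * r)
        - sn * (s * ((cn * c - sn * s) * (p ^ 2 + r ^ 2) / 2 - p * r))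
        = ((sn * c + cn * s) * q - s * p - sn * r) ^ 2 / 2 := by
      linear_combination (s ^ 2 * p ^ 2 / 2) * hid + (sn ^ 2 * r ^ 2 / 2) * hid1
    nlinarith

/-- The quadratic form of an antiperiodic sequence with weight `cos (π / N)` is nonnegative. -/
theorem antiperiodic_form_nonneg {N : ℕ} (hN : 2 ≤ N) (y : ℕ → ℝ) (hy : y N = -y 0) :
    0 ≤ ∑ i ∈ Finset.range N,
      (Real.cos (Real.pi / N) / 2 * (y i ^ 2 + y (i + 1) ^ 2) - y i * y (i + 1)) := by
  obtain ⟨j, rfl⟩ : ∃ j, N = j + 2 := ⟨N - 2, by omega⟩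
  -- The path has `N - 1` edges and angle `π - π / N`, so its lower bound is exactly cancelled by
  -- the closing edge with `y N = -y 0`.
  have h := sin_mul_path_form_ge hN y (j := j) le_rfl
  rw [Finset.sum_range_succ]
  have hN0 : (0 : ℝ) < (j + 2 : ℕ) := by positivity
  have hang : ((j + 1 : ℕ) : ℝ) * (Real.pi / (j + 2 : ℕ)) = Real.pi - Real.pi / (j + 2 : ℕ) := by
    field_simp
    push_cast
    ring
  rw [hang, Real.sin_pi_sub, Real.cos_pi_sub] at h
  have hs : 0 < Real.sin (Real.pi / (j + 2 : ℕ)) := by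
    apply Real.sin_pos_of_pos_of_lt_pi (by positivity)
    apply div_lt_self Real.pi_pos
    push_cast
    linarith [(Nat.cast_nonneg j : (0 : ℝ) ≤ j)]
  have h' := le_of_mul_le_mul_left h hs
  rw [show j + 1 + 1 = j + 2 from rfl, hy]
  linarith

/-- The planar part of the quadratic form of the rotated cyclic Laplacian is nonnegative. -/
theorem planar_form_nonneg {N : ℕ} [NeZero N] (hN : 2 ≤ N) (a b : ZMod N → ℝ) :
    0 ≤ ∑ i, (Real.cos (Real.pi / N) * (a i ^ 2 + b i ^ 2)
      - (Real.cos (Real.pi / N) * (a i * a (i + 1) + b i * b (i + 1))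
        + Real.sin (Real.pi / N) * (b i * a (i + 1) - a i * b (i + 1)))) := by
  set α := Real.pi / N with hα
  have hNα : (N : ℝ) * α = Real.pi := by
    have : (N : ℝ) ≠ 0 := by exact_mod_cast NeZero.ne N
    rw [hα]; field_simp
  -- Turning agent `j` by `j π / N` removes the rotation from every edge. A full cycle turns by `π`,
  -- so both coordinates become antiperiodic.
  let p : ℕ → ℝ := fun j => Real.cos (j * α) * a j - Real.sin (j * α) * b j
  let q : ℕ → ℝ := fun j => Real.sin (j * α) * a j + Real.cos (j * α) * b j
  have hp := antiperiodic_form_nonneg hN p (by simp [p, hNα])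
  have hq := antiperiodic_form_nonneg hN q (by simp [q, hNα])
  -- Each diagonal term is split equally between the two edges at its agent.
  have hshift : ∑ i, Real.cos α * (a i ^ 2 + b i ^ 2)
      = ∑ i, Real.cos α / 2 * ((a i ^ 2 + b i ^ 2) + (a (i + 1) ^ 2 + b (i + 1) ^ 2)) := by
    have h1 := ZMod.sum_add_const (fun i => Real.cos α / 2 * (a i ^ 2 + b i ^ 2)) 1
    simp only [mul_add (Real.cos α / 2) (_ + _), Finset.sum_add_distrib, h1]
    rw [← Finset.sum_add_distrib]
    exact Finset.sum_congr rfl fun i _ => by ring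
  rw [Finset.sum_sub_distrib, hshift, ← Finset.sum_sub_distrib, ZMod.sum_eq_sum_range]
  refine (add_nonneg hp hq).trans_eq ?_
  rw [← Finset.sum_add_distrib]
  refine Finset.sum_congr rfl fun j _ => ?_
  have hang : ((j : ℝ) + 1) * α = j * α + α := by ring
  have hn : ∀ i : ℕ, p i ^ 2 + q i ^ 2 = a i ^ 2 + b i ^ 2 := fun i => by
    simp only [p, q]
    linear_combination (a i ^ 2 + b i ^ 2) * Real.sin_sq_add_cos_sq (i * α)
  have hc : p j * p (j + 1) + q j * q (j + 1)
      = Real.cos α * (a j * a (j + 1) + b j * b (j + 1))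
        + Real.sin α * (b j * a (j + 1) - a j * b (j + 1)) := by
    simp only [p, q, Nat.cast_add, Nat.cast_one, hang, Real.cos_add, Real.sin_add]
    linear_combination (Real.cos α * (a j * a (j + 1) + b j * b (j + 1))
        + Real.sin α * (b j * a (j + 1) - a j * b (j + 1))) * Real.sin_sq_add_cos_sq (j * α)
  have h1 := hn j
  have h2 := hn (j + 1)
  push_cast at h2
  rw [← h1, ← h2, ← hc]
  ring

theorem axial_form_nonneg {N : ℕ} [NeZero N] (z : ZMod N → ℝ) :
    0 ≤ ∑ i, (z i ^ 2 - z i * z (i + 1)) := by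
  have h1 := ZMod.sum_add_const (fun i => z i ^ 2) 1
  have h2 : 0 ≤ ∑ i, (z i - z (i + 1)) ^ 2 := Finset.sum_nonneg fun i _ => sq_nonneg _
  have h3 : ∑ i, (z i - z (i + 1)) ^ 2 = 2 * ∑ i, (z i ^ 2 - z i * z (i + 1)) := by
    have : ∀ i, (z i - z (i + 1)) ^ 2 = z i ^ 2 - 2 * (z i * z (i + 1)) + z (i + 1) ^ 2 :=
      fun i => by ring
    simp only [this, Finset.sum_add_distrib, Finset.sum_sub_distrib, h1, ← Finset.mul_sum]
    ring
  linarith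

end Cyclic

/-! ### The formation matrices form a shape system -/

section Formation

variable {N d : ℕ}

/-- The block of a stacked vector that belongs to agent `i`. -/
def blk (y : ZMod N × Fin d → ℝ) (i : ZMod N) : Fin d → ℝ := fun k => y (i, k)

/-- The side from agent `i` to its successor. -/
def side (y : ZMod N × Fin d → ℝ) (i : ZMod N) : Fin d → ℝ := blk y (i + 1) - blk y i

/-- The deviation of a side from the rotated next side. -/
noncomputable def defect (y : ZMod N × Fin d → ℝ) (i : ZMod N) : Fin d → ℝ :=
  side y i - rot d (2 * Real.pi / N) *ᵥ side y (i + 1)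

variable [NeZero N]

theorem sum_side (y : ZMod N × Fin d → ℝ) : ∑ i, side y i = 0 := by
  simp only [side, Finset.sum_sub_distrib]
  rw [ZMod.sum_add_const (blk y) 1, sub_self]

theorem blk_symLaplacian_mulVec (y : ZMod N × Fin d → ℝ) (i : ZMod N) :
    blk (symLaplacian N d *ᵥ y) i = rot d (Real.pi / N) *ᵥ (blk y i - blk y (i + 1))
      + (rot d (Real.pi / N))ᵀ *ᵥ (blk y i - blk y (i - 1)) := by
  have hi : ∀ j : ZMod N, i = j + 1 ↔ j = i - 1 := fun j => by
    rw [eq_sub_iff_add_eq, eq_comm]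
  ext k
  simp only [blk, symLaplacian, mulVec, dotProduct, Fintype.sum_prod_type, Matrix.add_apply,
    kroneckerMap_apply, cyclicLaplacian, transpose_apply, of_apply, Pi.add_apply, Pi.sub_apply, hi]
  simp only [add_mul, sub_mul, mul_sub, Finset.sum_add_distrib, Finset.sum_sub_distrib, ite_mul,
    one_mul, zero_mul, @eq_comm _ i, Finset.sum_ite_irrel, Finset.sum_const_zero,
    Finset.sum_ite_eq', Finset.mem_univ, if_true]

theorem Vrn_mulVec (y : ZMod N × Fin d → ℝ) (p : VRow N d) :
    (Vrn N d *ᵥ y) p = defect y p.1.1 p.1.2 := by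
  have h2 : p.1.1 + 1 + 1 = p.1.1 + 2 := by ring
  simp only [Vrn, mulVec, dotProduct, Fintype.sum_prod_type, of_apply, defect, side, blk,
    Pi.sub_apply, h2]
  simp only [add_mul, sub_mul, mul_sub, neg_mul, Finset.sum_add_distrib, Finset.sum_sub_distrib,
    ite_mul, zero_mul, Finset.sum_ite_irrel, Finset.sum_const_zero, Finset.sum_neg_distrib,
    Finset.sum_ite_eq', Finset.mem_univ, if_true, Matrix.add_apply, Matrix.one_apply, one_mul,
    Finset.sum_ite_eq]
  ring

theorem D₂_mulVec (y : ZMod N × Fin d → ℝ) : D₂ N d *ᵥ y = side y 0 := by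
  ext k
  simp only [D₂, mulVec, dotProduct, Fintype.sum_prod_type, of_apply, side, blk, Pi.sub_apply,
    zero_add]
  simp only [ite_mul, zero_mul, Finset.sum_ite_eq', Finset.mem_univ, if_true, sub_mul, one_mul,
    Finset.sum_sub_distrib]

/-- The input matrix of the leader. -/
def leaderInput (N d : ℕ) : Matrix (ZMod N × Fin d) (Fin d) ℝ :=
  Matrix.of fun q k => if q = (0, k) then 1 else 0

omit [NeZero N] in
theorem blk_leaderInput_mulVec (v : Fin d → ℝ) (i : ZMod N) :
    blk (leaderInput N d *ᵥ v) i = if i = 0 then v else 0 := by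
  ext k
  by_cases h : i = 0 <;> simp [blk, leaderInput, mulVec, dotProduct, h]

omit [NeZero N] in
theorem leaderInput_mul_D₂ : leaderInput N d * D₂ N d = A₁ N d := by
  ext ⟨i, k⟩ q
  by_cases h : i = 0 <;> simp [leaderInput, A₁, Matrix.mul_apply, h]

theorem Vrn_mul_leaderInput : Vrn N d * leaderInput N d = D₁ N d := by
  ext p k
  simp [leaderInput, D₁, Matrix.mul_apply]

theorem D₂_mul_leaderInput (hN : 3 ≤ N) : D₂ N d * leaderInput N d = -1 := by
  have : Fact (1 < N) := ⟨by omega⟩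
  ext k l
  by_cases h : k = l
  · simp [leaderInput, D₂, Matrix.mul_apply, h]
  · simp [leaderInput, D₂, Matrix.mul_apply, h, Ne.symm h]

omit [NeZero N] in
-- For `N ≥ 3` the residues `0, 1, 2` are distinct, so the entry in the first row and first column
-- is `-1`.
theorem D₁_ne_zero (hN : 3 ≤ N) (hd : d = 2 ∨ d = 3) : D₁ N d ≠ 0 := by
  have : Fact (1 < N) := ⟨by omega⟩
  have hd0 : 0 < d := by omega
  have h2 : (0 : ZMod N) ≠ 2 := by
    intro h
    have := congrArg ZMod.val h
    rw [ZMod.val_zero, show (2 : ZMod N) = ((2 : ℕ) : ZMod N) by norm_cast,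
      ZMod.val_cast_of_lt (by omega)] at this
    omega
  intro h
  have h1 := congrFun (congrFun h ⟨(0, ⟨0, hd0⟩), Or.inl (by rw [ZMod.val_zero]; omega)⟩) ⟨0, hd0⟩
  simp [D₁, Vrn, h2] at h1

/-- Since `R(π/N)ᵀ R(2π/N) = R(π/N)`, factoring out `R(π/N)ᵀ` leaves the defect of the preceding
side. Thus rest states of the Laplacian are the regular formations. -/
theorem blk_symLaplacian_eq_defect (hd : d = 2 ∨ d = 3) (y : ZMod N × Fin d → ℝ) (i : ZMod N) :
    blk (symLaplacian N d *ᵥ y) (i + 1) = (rot d (Real.pi / N))ᵀ *ᵥ defect y i := by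
  have h : (rot d (Real.pi / N))ᵀ * rot d (2 * Real.pi / N) = rot d (Real.pi / N) := by
    rw [rot_transpose hd, rot_mul_rot hd]
    congr 1
    ring
  rw [blk_symLaplacian_mulVec, defect, mulVec_sub _ (side y i), mulVec_mulVec, h,
    add_sub_cancel_right, side,
    side, ← neg_sub (blk y (i + 1 + 1)), mulVec_neg]
  abel

theorem symLaplacian_mulVec_eq_zero_iff (hd : d = 2 ∨ d = 3) (y : ZMod N × Fin d → ℝ) :
    symLaplacian N d *ᵥ y = 0 ↔ ∀ i, defect y i = 0 := by
  constructor
  · intro h i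
    have h1 := blk_symLaplacian_eq_defect hd y i
    rw [h, rot_transpose hd] at h1
    refine rot_mulVec_injective hd (-(Real.pi / N)) ?_
    rw [← h1, mulVec_zero]
    rfl
  · intro h
    ext ⟨i, k⟩
    have h1 := blk_symLaplacian_eq_defect hd y (i - 1)
    rw [h, mulVec_zero, sub_add_cancel] at h1
    exact congrFun h1 k

omit [NeZero N] in
theorem cos_two_pi_div_lt_one (hN : 3 ≤ N) : Real.cos (2 * Real.pi / N) < 1 := by
  have hN' : (3 : ℝ) ≤ N := by exact_mod_cast hN
  have hpi := Real.pi_pos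
  have hpos : 0 < 2 * Real.pi / N := by positivity
  have hle : 2 * Real.pi / N ≤ Real.pi := by
    rw [div_le_iff₀ (by linarith)]
    nlinarith
  rw [← Real.cos_zero]
  exact Real.cos_lt_cos_of_nonneg_of_le_pi le_rfl hle hpos

theorem ZMod.val_add_two_lt {i : ZMod N} (h1 : i ≠ -1) (h2 : i ≠ -2) :
    i.val + 2 < N := by
  have hlt := i.val_lt
  by_contra hge
  have h3 : i.val + 1 = N ∨ i.val + 2 = N := by omega
  have hcast : ((i.val : ℕ) : ZMod N) = i := by simp
  rcases h3 with h3 | h3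
  · have := congrArg (Nat.cast : ℕ → ZMod N) h3
    push_cast at this
    rw [hcast, ZMod.natCast_self] at this
    exact h1 (eq_neg_of_add_eq_zero_left this)
  · have := congrArg (Nat.cast : ℕ → ZMod N) h3
    push_cast at this
    rw [hcast, ZMod.natCast_self] at this
    exact h2 (eq_neg_of_add_eq_zero_left this)

theorem ZMod.val_neg_one_add_one (hN : 3 ≤ N) : (-1 : ZMod N).val + 1 = N := by
  obtain ⟨m, rfl⟩ : ∃ m, N = m + 1 := ⟨N - 1, by omega⟩
  rw [ZMod.val_neg_one]

omit [NeZero N] in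
theorem ZMod.val_neg_two_add_two (hN : 3 ≤ N) : (-2 : ZMod N).val + 2 = N := by
  have h : ((N - 2 : ℕ) : ZMod N) = -2 := by
    rw [Nat.cast_sub (by omega), ZMod.natCast_self]
    simp
  rw [← h, ZMod.val_cast_of_lt (by omega)]
  omega

/-- The rotations by the multiples of `2π/N` compose along the cyclic order. -/
theorem rot_val_add_one (hd : d = 2 ∨ d = 3) (i : ZMod N) :
    rot d ((i + 1).val * (2 * Real.pi / N)) = rot d (i.val * (2 * Real.pi / N))
      * rot d (2 * Real.pi / N) := by
  rw [rot_mul_rot hd]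
  have hN0 : (N : ℝ) ≠ 0 := by exact_mod_cast NeZero.ne N
  have hval : (i + 1).val = i.val + 1 ∨ ((i + 1).val = 0 ∧ i.val + 1 = N) := by
    have hlt := i.val_lt
    have h1 : (i + 1).val = (i.val + 1) % N := by
      rw [← ZMod.val_natCast]
      simp
    rcases Nat.lt_or_ge (i.val + 1) N with h | h
    · left; rw [h1, Nat.mod_eq_of_lt h]
    · have h2 : i.val + 1 = N := by omega
      right; rw [h1, h2, Nat.mod_self]; exact ⟨rfl, rfl⟩
  rcases hval with h | ⟨h, h'⟩
  · rw [h]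
    congr 1
    push_cast
    ring
  · have h2 : (i.val : ℝ) * (2 * Real.pi / N) + 2 * Real.pi / N = 2 * Real.pi := by
      have : (i.val : ℝ) + 1 = N := by exact_mod_cast h'
      field_simp
      linarith
    rw [h, h2, rot_two_pi hd, Nat.cast_zero, zero_mul, rot_zero hd]

theorem sum_defect (y : ZMod N × Fin d → ℝ) : ∑ i, defect y i = 0 := by
  have h := ZMod.sum_add_const (side y) 1
  simp only [defect, Finset.sum_sub_distrib]
  rw [← mulVec_sum, h, sum_side, mulVec_zero, sub_zero]

/-- With `R = R(2π/N)`, the `i`-th term is `Rⁱ side i - Rⁱ⁺¹ side (i + 1)`, and the sum telescopes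
around the cycle because `Rᴺ = 1`. -/
theorem sum_rot_mulVec_defect (hd : d = 2 ∨ d = 3) (y : ZMod N × Fin d → ℝ) :
    ∑ i : ZMod N, rot d (i.val * (2 * Real.pi / N)) *ᵥ defect y i = 0 := by
  have h := ZMod.sum_add_const
    (fun i : ZMod N => rot d (i.val * (2 * Real.pi / N)) *ᵥ side y i) 1
  simp only [defect, mulVec_sub, mulVec_mulVec, ← rot_val_add_one hd, Finset.sum_sub_distrib]
  rw [h, sub_self]

/-- The null space of `Vrn` consists of the regular formations. -/
theorem Vrn_mulVec_eq_zero_iff (hN : 3 ≤ N) (hd : d = 2 ∨ d = 3) (y : ZMod N × Fin d → ℝ) :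
    Vrn N d *ᵥ y = 0 ↔ ∀ i, defect y i = 0 := by
  constructor
  swap
  · intro h
    ext p
    rw [Vrn_mulVec, h]
    rfl
  intro h
  have hrow : ∀ p : VRow N d, defect y p.1.1 p.1.2 = 0 := fun p => by
    rw [← Vrn_mulVec, h]
    rfl
  have hzero : ∀ i : ZMod N, i ≠ -2 ∧ i ≠ -1 → defect y i = 0 := fun i hi =>
    funext fun k => hrow ⟨(i, k), Or.inl (ZMod.val_add_two_lt hi.2 hi.1)⟩
  have hax : ∀ k : Fin d, 2 ≤ (k : ℕ) → defect y (-2) k = 0 := fun k hk =>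
    hrow ⟨(-2, k), Or.inr ⟨ZMod.val_neg_two_add_two hN, hk⟩⟩
  have hne : (-2 : ZMod N) ≠ -1 := fun h => by
    have h1 := congrArg ZMod.val h
    have h2 := ZMod.val_neg_one_add_one hN
    have h3 := ZMod.val_neg_two_add_two hN
    omega
  -- Only the defects at `-2` and `-1` are left. The two sums give `defect (-2) + defect (-1) = 0`
  -- and `defect (-2) + R defect (-1) = 0`, so `R` fixes the last one, whose axial part vanishes by
  -- the extra row.
  have hs1 := sum_defect y
  rw [Fintype.sum_eq_add _ _ hne hzero] at hs1
  have hs2 := sum_rot_mulVec_defect hd y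
  rw [Fintype.sum_eq_add _ _ hne (fun i hi => by rw [hzero i hi, mulVec_zero]),
    show (-1 : ZMod N) = -2 + 1 by ring, rot_val_add_one hd, ← mulVec_mulVec, ← mulVec_add,
    show (-2 + 1 : ZMod N) = -1 by ring] at hs2
  have hs3 : defect y (-2) + rot d (2 * Real.pi / N) *ᵥ defect y (-1) = 0 :=
    rot_mulVec_injective hd _ (hs2.trans (mulVec_zero _).symm)
  have h2 : defect y (-2) = -defect y (-1) := eq_neg_of_add_eq_zero_left hs1
  have h1 : defect y (-1) = 0 := by
    refine eq_zero_of_rot_mulVec_eq_self hd (cos_two_pi_div_lt_one hN) ?_ fun k hk => ?_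
    · rw [h2, neg_add_eq_zero] at hs3
      exact hs3.symm
    · have := congrFun h2 k
      rw [hax k hk, Pi.neg_apply] at this
      linarith
  intro i
  by_cases hi1 : i = -1
  · rw [hi1, h1]
  by_cases hi2 : i = -2
  · rw [hi2, h2, h1, neg_zero]
  exact hzero i ⟨hi2, hi1⟩

/-- `Vrn` has full row rank. -/
theorem eq_zero_of_Vrn_transpose_mulVec (hN : 3 ≤ N) (hd : d = 2 ∨ d = 3) (z : VRow N d → ℝ)
    (h : (Vrn N d)ᵀ *ᵥ z = 0) : z = 0 := by
  let w : ZMod N × Fin d → ℝ := fun q =>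
    if hq : q.1.val + 2 < N ∨ (q.1.val + 2 = N ∧ 2 ≤ (q.2 : ℕ)) then z ⟨q, hq⟩ else 0
  have hwz : ∀ p : VRow N d, w p.1 = z p := fun p => dif_pos p.2
  have hw0 : ∀ q : ZMod N × Fin d,
      ¬(q.1.val + 2 < N ∨ (q.1.val + 2 = N ∧ 2 ≤ (q.2 : ℕ))) → w q = 0 := fun q hq => dif_neg hq
  have hsum : ∀ F : ZMod N × Fin d → ℝ, ∑ p : VRow N d, F p.1 * z p = ∑ q, F q * w q := by
    intro F
    refine Fintype.sum_of_injective Subtype.val Subtype.val_injective _ _ (fun q hq => ?_)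
      fun p => by rw [hwz]
    rw [hw0 q fun hq' => hq ⟨⟨q, hq'⟩, rfl⟩, mul_zero]
  -- Extended by zero over the missing rows, `z` becomes a cyclic sequence `w`. Column `j + 2` reads
  -- `-w (j+2) + (1 + Rᵀ) w (j+1) - Rᵀ w j = 0`.
  have hside : ∀ j, side w (j + 1) = (rot d (2 * Real.pi / N))ᵀ *ᵥ side w j := by
    intro j
    have e0 : ∀ i : ZMod N, j + 2 = i ↔ i = j + 1 + 1 := fun i => by
      rw [add_assoc, one_add_one_eq_two, eq_comm]
    have e1 : ∀ i : ZMod N, j + 2 = i + 1 ↔ i = j + 1 := fun i => by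
      rw [← one_add_one_eq_two, ← add_assoc, add_left_inj, eq_comm]
    have e2 : ∀ i : ZMod N, j + 2 = i + 2 ↔ i = j := fun i => by
      rw [add_left_inj, eq_comm]
    ext l
    have h1 : ((Vrn N d)ᵀ *ᵥ z) (j + 2, l) = 0 := by rw [h]; rfl
    have h2 := hsum fun q =>
      -(if j + 2 = q.1 then (1 : Matrix (Fin d) (Fin d) ℝ) q.2 l else 0)
        + (if j + 2 = q.1 + 1 then (1 + rot d (2 * Real.pi / N)) q.2 l else 0)
        - (if j + 2 = q.1 + 2 then rot d (2 * Real.pi / N) q.2 l else 0)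
    replace h2 := h2.symm.trans h1
    simp only [e1, e2] at h2
    simp only [Fintype.sum_prod_type, e0, add_mul, sub_mul, neg_mul, ite_mul, zero_mul,
      Finset.sum_add_distrib, Finset.sum_sub_distrib, Finset.sum_neg_distrib,
      Finset.sum_ite_irrel, Finset.sum_const_zero, Finset.sum_ite_eq', Finset.mem_univ, if_true,
      Matrix.add_apply, Matrix.one_apply, one_mul] at h2
    simp only [side, blk, mulVec, dotProduct, transpose_apply, Pi.sub_apply, mul_sub,
      Finset.sum_sub_distrib]
    linarith
  have hlast : blk w (-1) = 0 := funext fun k => hw0 _ (by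
    have := ZMod.val_neg_one_add_one hN
    simp only
    omega)
  -- Axial components of the sides are constant along the cycle and sum to zero; planar ones vanish
  -- here because the rows at `-2` and `-1` carry no planar entries.
  have hside2 : side w (-2) = 0 := by
    ext k
    by_cases hk : 2 ≤ (k : ℕ)
    · have hconst : ∀ i, side w i k = side w (-2) k :=
        ZMod.forall_of_add_one rfl fun i hi => by
          rw [hside, rot_transpose hd, rot_mulVec_axial _ _ hk, hi]
      have hs := congrFun (sum_side w) k
      rw [Finset.sum_apply, Finset.sum_congr rfl fun i _ => hconst i, Finset.sum_const,
        Finset.card_univ, ZMod.card, nsmul_eq_mul, Pi.zero_apply] at hs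
      exact (mul_eq_zero.1 hs).resolve_left (by exact_mod_cast NeZero.ne N)
    · have h1 : w (-2, k) = 0 := hw0 _ (by
        have := ZMod.val_neg_two_add_two hN
        simp only
        omega)
      have h2 := congrFun hlast k
      rw [side, show (-2 + 1 : ZMod N) = -1 by ring, Pi.sub_apply, h2]
      simp [blk, h1]
  have hside0 : ∀ i, side w i = 0 :=
    ZMod.forall_of_add_one hside2 fun i hi => by rw [hside, hi, mulVec_zero]
  have hblk : ∀ i, blk w i = 0 :=
    ZMod.forall_of_add_one hlast fun i hi => by
      have := hside0 i
      rwa [side, hi, sub_zero] at this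
  ext p
  rw [← hwz]
  exact congrFun (hblk p.1.1) p.1.2

/-- Transposition and an index shift show that the two halves of `symLaplacian` contribute equally.
-/
theorem symLaplacian_form (y : ZMod N × Fin d → ℝ) :
    y ⬝ᵥ (symLaplacian N d *ᵥ y)
      = 2 * ∑ i, blk y i ⬝ᵥ (rot d (Real.pi / N) *ᵥ (blk y i - blk y (i + 1))) := by
  have h1 : y ⬝ᵥ (symLaplacian N d *ᵥ y) = ∑ i, blk y i ⬝ᵥ blk (symLaplacian N d *ᵥ y) i :=
    Fintype.sum_prod_type _
  have h2 : ∀ v w : Fin d → ℝ, v ⬝ᵥ ((rot d (Real.pi / N))ᵀ *ᵥ w)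
      = w ⬝ᵥ (rot d (Real.pi / N) *ᵥ v) := fun v w => by
    rw [mulVec_transpose, dotProduct_comm, ← dotProduct_mulVec]
  have h3 := ZMod.sum_add_const
    (fun i => blk y (i - 1) ⬝ᵥ (rot d (Real.pi / N) *ᵥ blk y i)) 1
  simp only [add_sub_cancel_right] at h3
  rw [h1]
  simp only [blk_symLaplacian_mulVec, dotProduct_add, h2, mulVec_sub, dotProduct_sub,
    Finset.sum_add_distrib, Finset.sum_sub_distrib, ← h3]
  ring

theorem symLaplacian_posSemidef (hN : 3 ≤ N) (hd : d = 2 ∨ d = 3) :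
    (symLaplacian N d).PosSemidef := by
  refine .of_dotProduct_mulVec_nonneg ?_ fun y => ?_
  · rw [IsHermitian, conjTranspose_eq_transpose_of_trivial, symLaplacian, transpose_add,
      kroneckerMap_transpose, transpose_transpose, add_comm]
  · rw [star_trivial, symLaplacian_form]
    have hp := planar_form_nonneg (N := N) (by omega)
    refine mul_nonneg zero_le_two ?_
    rcases hd with rfl | rfl
    · refine (hp (fun i => y (i, 0)) fun i => y (i, 1)).trans_eq
        (Finset.sum_congr rfl fun i _ => ?_)
      simp [rot, blk, mulVec, dotProduct, Fin.sum_univ_succ]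
      ring
    · refine (add_nonneg (hp (fun i => y (i, 0)) fun i => y (i, 1))
        (axial_form_nonneg fun i => y (i, 2))).trans_eq ?_
      rw [← Finset.sum_add_distrib]
      refine Finset.sum_congr rfl fun i _ => ?_
      simp [rot, blk, mulVec, dotProduct, Fin.sum_univ_succ]
      ring

/-- The shape system of the formation control problem. -/
noncomputable def formationSystem (hN : 3 ≤ N) (hd : d = 2 ∨ d = 3) :
    ShapeSystem (ZMod N × Fin d) (VRow N d) (Fin d) where
  L := symLaplacian N d
  V := Vrn N d
  B := leaderInput N d
  G := D₂ N d
  posSemidef := symLaplacian_posSemidef hN hd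
  mulVec_eq_zero_iff y := by
    rw [Vrn_mulVec_eq_zero_iff hN hd, symLaplacian_mulVec_eq_zero_iff hd]
  eq_zero_of_transpose := eq_zero_of_Vrn_transpose_mulVec hN hd
  G_mul_B := D₂_mul_leaderInput hN
  V_mul_B_ne_zero := by
    rw [Vrn_mul_leaderInput]
    exact D₁_ne_zero hN hd

end Formation

/-! ### Transfer from stacked vectors to agents -/

section Transfer

variable {N d : ℕ} [NeZero N]

/-- Stacking as a linear equivalence. -/
noncomputable def stackEquiv (N d : ℕ) [NeZero N] :
    Config N d ≃L[ℝ] (ZMod N × Fin d → ℝ) :=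
  LinearEquiv.toContinuousLinearEquiv
    { toFun := stack
      invFun := fun y i => WithLp.toLp 2 (blk y i)
      map_add' := fun _ _ => rfl
      map_smul' := fun _ _ => rfl
      left_inv := fun _ => rfl
      right_inv := fun _ => rfl }

theorem stackEquiv_apply (x : Config N d) : stackEquiv N d x = stack x := rfl

omit [NeZero N] in
theorem norm_sq_side (x : Config N d) (i : ZMod N) :
    ‖x (i + 1) - x i‖ ^ 2 = side (stack x) i ⬝ᵥ side (stack x) i := by
  rw [EuclideanSpace.real_norm_sq_eq]
  exact Finset.sum_congr rfl fun k _ => sq _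

theorem sizeError_eq (hN : 3 ≤ N) (hd : d = 2 ∨ d = 3) (ρ : ℝ) (x : Config N d) :
    sizeError ρ x = (formationSystem hN hd).sqSide (stack x) - ρ := by
  rw [sizeError, ShapeSystem.sqSide, show (formationSystem hN hd).G = D₂ N d from rfl, D₂_mulVec,
    ← norm_sq_side, zero_add]

theorem stack_controlLaw (hN : 3 ≤ N) (hd : d = 2 ∨ d = 3) (f : ℝ → ℝ) (ρ : ℝ) (x : Config N d) :
    stack (controlLaw N d f ρ x) = (formationSystem hN hd).field f ρ (stack x) := by
  ext ⟨i, k⟩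
  have h1 := congrFun (blk_symLaplacian_mulVec (stack x) i) k
  have h2 := congrFun (blk_leaderInput_mulVec (side (stack x) 0) i) k
  have h3 : (formationSystem hN hd).field f ρ (stack x) (i, k)
      = -(blk (symLaplacian N d *ᵥ stack x) i k)
        + f (sizeError ρ x) * blk (leaderInput N d *ᵥ side (stack x) 0) i k := by
    rw [sizeError_eq hN hd, ← D₂_mulVec]
    rfl
  have h4 : ∀ j, (x j - x i).ofLp = -(blk (stack x) i - blk (stack x) j) := fun j => by
    rw [neg_sub]
    rfl
  rw [h3, h1, h2]
  simp only [stack, controlLaw, act, PiLp.add_apply, h4, mulVec_neg, Pi.neg_apply, Pi.add_apply]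
  by_cases hi : i = 0
  · simp [hi, side, blk, stack]
    ring
  · simp [hi]
    ring

theorem isForwardSolution_stack_iff (hN : 3 ≤ N) (hd : d = 2 ∨ d = 3) {f : ℝ → ℝ} {ρ : ℝ}
    {x : ℝ → Config N d} :
    (formationSystem hN hd).IsForwardSolution f ρ (fun t => stack (x t)) ↔
      IsSolution N d f ρ x := by
  constructor
  · intro h t ht
    have h1 := (stackEquiv N d).symm.hasFDerivAt.comp_hasDerivWithinAt t (h t ht)
    rw [← stack_controlLaw, ← stackEquiv_apply] at h1
    exact h1.congr_deriv ((stackEquiv N d).symm_apply_apply _)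
  · intro h t ht
    rw [← stack_controlLaw]
    exact (stackEquiv N d).hasFDerivAt.comp_hasDerivWithinAt t (h t ht)

omit [NeZero N] in
theorem mem_regularFormations_iff (x : Config N d) :
    x ∈ regularFormations N d ↔ ∀ i, defect (stack x) i = 0 := by
  refine forall_congr' fun i => ?_
  have h2 : i + 2 = i + 1 + 1 := by ring
  rw [defect, sub_eq_zero, h2]
  constructor
  · intro h
    exact congrArg WithLp.ofLp h
  · intro h
    ext k
    exact congrFun h k

theorem side_dotProduct_self_eq (hd : d = 2 ∨ d = 3) {y : ZMod N × Fin d → ℝ}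
    (hy : ∀ i, defect y i = 0) (i : ZMod N) : side y i ⬝ᵥ side y i = side y 0 ⬝ᵥ side y 0 := by
  refine ZMod.forall_of_add_one (P := fun i => side y i ⬝ᵥ side y i = side y 0 ⬝ᵥ side y 0)
    rfl (fun i hi => ?_) i
  have h := hy i
  rw [defect, sub_eq_zero] at h
  rw [← hi, h, rot_mulVec_dotProduct_self hd]

theorem convergesExp_of_convergesToSized (hN : 3 ≤ N) (hd : d = 2 ∨ d = 3) {ρ r : ℝ}
    {x : ℝ → Config N d}
    (h : (formationSystem hN hd).ConvergesToSized ρ r fun t => stack (x t)) :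
    ConvergesExp N d ρ r x := by
  obtain ⟨z, hz, hzρ, C, hC⟩ := h
  have hdef := (Vrn_mulVec_eq_zero_iff hN hd z).1 hz
  have hstack : stack ((stackEquiv N d).symm z) = z := (stackEquiv N d).apply_symm_apply z
  refine ⟨(stackEquiv N d).symm z, ⟨?_, fun i => ?_⟩,
    ‖((stackEquiv N d).symm : (ZMod N × Fin d → ℝ) →L[ℝ] Config N d)‖ * C, fun t ht i => ?_⟩
  · rw [mem_regularFormations_iff, hstack]
    exact hdef
  · rw [norm_sq_side, hstack, side_dotProduct_self_eq hd hdef, ← hzρ, ← D₂_mulVec]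
    rfl
  · have h1 : x t - (stackEquiv N d).symm z = (stackEquiv N d).symm (stack (x t) - z) := by
      rw [map_sub, ← stackEquiv_apply, ContinuousLinearEquiv.symm_apply_apply]
    refine (norm_le_pi_norm (x t - (stackEquiv N d).symm z) i).trans ?_
    rw [h1, mul_assoc]
    exact (((stackEquiv N d).symm : (ZMod N × Fin d → ℝ) →L[ℝ] Config N d).le_opNorm _).trans
      (mul_le_mul_of_nonneg_left (hC t ht) (norm_nonneg _))

/-- `A` factors as `(A ∘ U) ∘ T`, where `U` extends a right inverse of `T` onto its range; `A ∘ U`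
is continuous because `F` is finite-dimensional. -/
theorem LinearMap.tendsto_zero_of_ker_le {E F G α : Type*} [NormedAddCommGroup E]
    [NormedSpace ℝ E] [NormedAddCommGroup F] [NormedSpace ℝ F] [FiniteDimensional ℝ F]
    [NormedAddCommGroup G] [NormedSpace ℝ G] (T : E →ₗ[ℝ] F) (A : E →ₗ[ℝ] G)
    (hker : LinearMap.ker T ≤ LinearMap.ker A) {l : Filter α} {x : α → E}
    (h : Tendsto (fun a => T (x a)) l (𝓝 0)) : Tendsto (fun a => A (x a)) l (𝓝 0) := by
  obtain ⟨g, hg⟩ := T.rangeRestrict.exists_rightInverse_of_surjective T.range_rangeRestrict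
  obtain ⟨U, hU⟩ := LinearMap.exists_extend g
  have hTU : ∀ y, T (U (T y)) = T y := fun y => by
    have h1 : U (T y) = g (T.rangeRestrict y) := LinearMap.congr_fun hU (T.rangeRestrict y)
    rw [h1]
    exact congrArg Subtype.val (LinearMap.congr_fun hg (T.rangeRestrict y))
  have hA : ∀ y, A (U (T y)) = A y := fun y => by
    have h1 : U (T y) - y ∈ LinearMap.ker T := by
      rw [LinearMap.mem_ker, map_sub, hTU, sub_self]
    have h2 := LinearMap.mem_ker.1 (hker h1)
    rwa [map_sub, sub_eq_zero] at h2
  have hc : Continuous (A ∘ₗ U) := LinearMap.continuous_of_finiteDimensional _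
  have h1 := (hc.tendsto 0).comp h
  rw [map_zero] at h1
  exact h1.congr fun a => hA _

/-- Zero shape means a regular formation whose leading side is zero; all sides have equal length, so
all agents coincide. Position differences thus vanish on the kernel of `shape`. -/
theorem tendsto_norm_sub_of_tendsto_shape (hN : 3 ≤ N) (hd : d = 2 ∨ d = 3)
    {x : ℝ → Config N d}
    (h : Tendsto (fun t => (formationSystem hN hd).shape (stack (x t))) atTop (𝓝 0))
    (i j : ZMod N) : Tendsto (fun t => ‖x t i - x t j‖) atTop (𝓝 0) := by
  let T : Config N d →ₗ[ℝ] (VRow N d → ℝ) × (Fin d → ℝ) :=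
    (formationSystem hN hd).shape.toLinearMap ∘ₗ
      (stackEquiv N d).toLinearEquiv.toLinearMap
  let A : Config N d →ₗ[ℝ] EuclideanSpace ℝ (Fin d) :=
    LinearMap.proj (R := ℝ) (φ := fun _ : ZMod N => EuclideanSpace ℝ (Fin d)) i
      - LinearMap.proj (R := ℝ) (φ := fun _ : ZMod N => EuclideanSpace ℝ (Fin d)) j
  have hker : LinearMap.ker T ≤ LinearMap.ker A := by
    intro y hy
    have hy0 : (formationSystem hN hd).shape (stack y) = 0 := LinearMap.mem_ker.1 hy
    obtain ⟨h1, h2⟩ := Prod.ext_iff.1 hy0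
    have hV : Vrn N d *ᵥ stack y = 0 := by
      have h3 := (formationSystem hN hd).gram_mulVec_coord (stack y)
      rw [show (formationSystem hN hd).coord *ᵥ stack y = 0 from h1, mulVec_zero] at h3
      exact h3.symm
    have hdef := (Vrn_mulVec_eq_zero_iff hN hd _).1 hV
    have hside0 : side (stack y) 0 = 0 := by
      rw [← D₂_mulVec]
      exact h2
    have hstep : ∀ l, y (l + 1) = y l := fun l => by
      have h4 := norm_sq_side y l
      rw [side_dotProduct_self_eq hd hdef, hside0, dotProduct_zero] at h4
      exact sub_eq_zero.1 (norm_eq_zero.1 (pow_eq_zero_iff two_ne_zero |>.1 h4))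
    have hall : ∀ l, y l = y j := ZMod.forall_of_add_one rfl fun l hl => (hstep l).trans hl
    rw [LinearMap.mem_ker]
    exact sub_eq_zero.2 (hall i)
  have h1 := LinearMap.tendsto_zero_of_ker_le T A hker h
  have h2 := h1.norm
  rw [norm_zero] at h2
  exact h2

/-- At `(z, θ φ)` the factor `θ⁻¹` of the column cancels, while the row and the corner each acquire
`θ²`; the corner is negative because `D₂ * leaderInput = -1`. -/
theorem auxJacobian_form (hN : 3 ≤ N) (hd : d = 2 ∨ d = 3) (f : ℝ → ℝ) (ρ : ℝ) {θ : ℝ}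
    (hθ : θ ≠ 0) (x : Config N d) (z : VRow N d → ℝ) (φ : ℝ) :
    Sum.elim z (fun _ : Unit => θ * φ) ⬝ᵥ
        (auxJacobian N d f ρ θ x *ᵥ Sum.elim z fun _ : Unit => θ * φ)
      = (formationSystem hN hd).dissip θ (deriv f (sizeError ρ x)) z
          (φ • ((formationSystem hN hd).G *ᵥ stack x)) := by
  set s := deriv f (sizeError ρ x) with hs
  have hu : (x 1 - x 0).ofLp = D₂ N d *ᵥ stack x := by
    rw [D₂_mulVec, side, zero_add]
    rfl
  have hA : A₁ N d *ᵥ stack x = leaderInput N d *ᵥ (D₂ N d *ᵥ stack x) := by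
    rw [mulVec_mulVec, leaderInput_mul_D₂]
  have hsys : (formationSystem hN hd).dissip θ s z (φ • ((formationSystem hN hd).G *ᵥ stack x))
      = -(z ⬝ᵥ (projLaplacian N d *ᵥ z))
        + z ⬝ᵥ ((Vrn N d * leaderInput N d) *ᵥ (φ • (D₂ N d *ᵥ stack x)))
        - (2 * θ ^ 2 * s) * ((φ • (D₂ N d *ᵥ stack x)) ⬝ᵥ
          ((D₂ N d * symLaplacian N d * (Vrn N d)ᵀ) *ᵥ z))
        - (2 * θ ^ 2 * s) * ((φ • (D₂ N d *ᵥ stack x)) ⬝ᵥ (φ • (D₂ N d *ᵥ stack x))) := rfl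
  rw [hsys]
  set u := D₂ N d *ᵥ stack x with hu'
  have hgrad : gradGain f ρ x = (2 * s) • (u ᵥ* D₂ N d) := by rw [gradGain, hu]
  have h1 : (gradGain f ρ x ᵥ* (symLaplacian N d * (Vrn N d)ᵀ)) ⬝ᵥ z
      = 2 * s * (u ⬝ᵥ ((D₂ N d * symLaplacian N d * (Vrn N d)ᵀ) *ᵥ z)) := by
    rw [hgrad, smul_vecMul, smul_dotProduct, smul_eq_mul, vecMul_vecMul, ← dotProduct_mulVec,
      Matrix.mul_assoc]
  have h2 : gradGain f ρ x ⬝ᵥ (A₁ N d *ᵥ stack x) = -(2 * s * (u ⬝ᵥ u)) := by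
    rw [hgrad, hA, smul_dotProduct, smul_eq_mul, ← dotProduct_mulVec, mulVec_mulVec,
      D₂_mul_leaderInput hN, neg_mulVec, one_mulVec, dotProduct_neg, mul_neg]
  have hcol : ∀ w : VRow N d → ℝ,
      replicateCol Unit w *ᵥ (fun _ : Unit => θ * φ) = (θ * φ) • w := fun w => by
    ext p
    simp [mulVec, dotProduct, mul_comm]
  have hrow : ∀ w : VRow N d → ℝ,
      replicateRow Unit w *ᵥ z = fun _ : Unit => w ⬝ᵥ z := fun w => rfl
  have hcorner : ∀ g : ℝ, (Matrix.of fun _ _ : Unit => g) *ᵥ (fun _ : Unit => θ * φ)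
      = fun _ : Unit => g * (θ * φ) := fun g => by
    ext
    simp [mulVec, dotProduct]
  have hunit : ∀ a b : ℝ, (fun _ : Unit => a) ⬝ᵥ (fun _ : Unit => b) = a * b := fun a b => by
    simp [dotProduct]
  rw [auxJacobian, fromBlocks_mulVec, h2]
  simp only [Sum.elim_comp_inl, Sum.elim_comp_inr, hcol, hrow, hcorner, sumElim_dotProduct_sumElim,
    dotProduct_add, hunit, hA, neg_mulVec, dotProduct_neg, dotProduct_smul, smul_dotProduct,
    neg_dotProduct, smul_eq_mul, mulVec_smul, h1, mulVec_mulVec]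
  field_simp
  ring

end Transfer

theorem mainTheorem8 (N : ℕ) [NeZero N] (hN : 3 ≤ N) (d : ℕ) (hd : d = 2 ∨ d = 3)
    (ρ : ℝ) (hρ : 0 < ρ) (f : ℝ → ℝ) (hf : ContDiff ℝ 1 f) (hf0 : f 0 = 0)
    (hf' : ∀ p : ℝ, -ρ ≤ p → 0 < deriv f p) (θ : ℝ) (hθ : 0 < θ) :
    -- sufficient condition in terms of the slope of `f` alone
    ((∀ p : ℝ, -ρ ≤ p → SchurCondition N d θ (deriv f p)) →
      (∀ x₀ : Config N d, ∃ x : ℝ → Config N d, IsSolution N d f ρ x ∧ x 0 = x₀) ∧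
      ∃ r : ℝ, 0 < r ∧ ∀ x : ℝ → Config N d, IsSolution N d f ρ x →
        ConvergesExp N d ρ r x ∨
          ∀ i j, Tendsto (fun t => ‖x t i - x t j‖) atTop (𝓝 0)) ∧
    -- sufficient condition in terms of the Jacobian of the auxiliary system
    (∀ c : ℝ, 0 < c → ∃ r : ℝ, 0 < r ∧ ∀ x : ℝ → Config N d, IsSolution N d f ρ x →
      (∀ t : ℝ, 0 ≤ t → ∀ v : VRow N d ⊕ Unit → ℝ,
        v ⬝ᵥ (auxJacobian N d f ρ θ (x t) *ᵥ v) ≤ -c * (v ⬝ᵥ v)) →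
      ConvergesExp N d ρ r x) := by
  have hsol := fun x => isForwardSolution_stack_iff hN hd (f := f) (ρ := ρ) (x := x)
  set S := formationSystem hN hd with hS
  constructor
  · intro hschur
    have hneg : ∀ p : ℝ, -ρ ≤ p → ∀ (z : VRow N d → ℝ) (v : Fin d → ℝ), (z, v) ≠ 0 →
        S.dissip θ (deriv f p) z v < 0 := fun p hp z v hzv => by
      refine S.dissip_neg_of_schur ?_ hzv
      have h := hschur p hp
      rw [SchurCondition, ← Vrn_mul_leaderInput] at h
      exact h
    refine ⟨fun x₀ => ?_, ?_⟩
    · obtain ⟨ξ, hξ, hξ0⟩ :=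
        S.exists_isForwardSolution hf hf0 hρ hf' hθ hneg (stack x₀)
      refine ⟨fun t => (stackEquiv N d).symm (ξ t), (hsol _).1 hξ, ?_⟩
      simp only [hξ0, ← stackEquiv_apply, ContinuousLinearEquiv.symm_apply_apply]
    · obtain ⟨r, hr, h⟩ := S.exists_rate_convergesToSized_or_collapse hf hf0 hρ hf' hθ hneg
      refine ⟨r, hr, fun x hx => ?_⟩
      rcases h _ ((hsol x).2 hx) with h1 | h1
      · exact Or.inl (convergesExp_of_convergesToSized hN hd h1)
      · exact Or.inr (tendsto_norm_sub_of_tendsto_shape hN hd h1)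
  · intro c hc
    obtain ⟨r, hr, h⟩ := S.exists_rate_of_uniform_dissip hf hf0 hρ hf' hθ hc
    refine ⟨r, hr, fun x hx hJ => convergesExp_of_convergesToSized hN hd
      (h _ ((hsol x).2 hx) fun t ht => ?_)⟩
    -- Negativity is needed only at the vector `(z, θ φ)` built from the state itself.
    have h1 := hJ t ht (Sum.elim (S.coord *ᵥ stack (x t))
      fun _ => θ * S.gain f ρ (stack (x t)))
    rw [auxJacobian_form hN hd f ρ hθ.ne', sumElim_dotProduct_sumElim, sizeError_eq hN hd] at h1
    refine h1.trans_eq ?_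
    simp [dotProduct, sq]
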